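/- All graphs are finite, simple and nonempty. For a graph $G$ let $\mathrm{Adj}(G)$ be its adjacency matrix and $\mathrm{Aut}(G)$ its automorphism group. **Definitions.** The class of *tree-cographs* is the smallest class of graphs (up to isomorphism) that contains all trees and is closed under disjoint sums and complements. A *magic unitary* with coefficients in a unital $*$-algebra is a square matrix $P=(p_{ij})$ such that $p_{ij}=p_{ij}^*=p_{ij}^2$ for all $i,j$, every row and every column of $P$ sums to $1$, and $p_{ij}p_{ik}=0$ for $j\neq k$ and $p_{ij}p_{kj}=0$ for $i\neq k$. Let $\mathcal O(\mathrm{Qu}(G))$, the coefficient algebra of the quantum automorphism group $\mathrm{Qu}(G)$, be the universal unital complex $*$-algebra generated by the coefficients of a magic unitary, indexed by $V(G)\times V(G)$, that commutes with $\mathrm{Adj}(G)$. * $G$ is *asymmetric* if $\mathrm{Aut}(G)$ is trivial, and *quantum asymmetric* if $\mathrm{Qu}(G)$ is trivial, that is, if $\mathcal O(\mathrm{Qu}(G))\cong\mathbb C$. * $G$ *has quantum symmetry* if $\mathcal O(\mathrm{Qu}(G))$ is not commutative. * $G$ *satisfies Schmidt's criterion* if it has two nontrivial automorphisms $f,g$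 with disjoint supports, where $\mathrm{Supp}(f)=\{x\in V(G)\mid f(x)\neq x\}$. * $G$ is *quantum isomorphic* to $H$ if there is a magic unitary $P$, indexed by $V(H)\times V(G)$, with coefficients in a nonzero unital $C^*$-algebra, such that $P\,\mathrm{Adj}(G)=\mathrm{Adj}(H)\,P$. **Theorem.** The class of tree-cographs is tractable, that is: * (QA) a tree-cograph is asymmetric if and only if it is quantum asymmetric; * (QI) two tree-cographs are quantum isomorphic if and only if they are isomorphic; * (SA) a tree-cograph has quantum symmetry if and only if it satisfies Schmidt's criterion. -/

import Mathlib

universe u w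

/-! ### Free unital `*`-algebras over `ℂ` -/

/-- The algebra of noncommutative `*`-polynomials in variables indexed by `X`: the free unital
complex algebra on two copies of `X`, the variables `x` and their formal adjoints `x⋆`. -/
def FreeStarAlgebra (X : Type u) : Type u := FreeAlgebra ℂ (X ⊕ X)

namespace FreeStarAlgebra

variable {X : Type u}

noncomputable instance : Ring (FreeStarAlgebra X) :=
  inferInstanceAs (Ring (FreeAlgebra ℂ (X ⊕ X)))

noncomputable instance : Algebra ℂ (FreeStarAlgebra X) :=
  inferInstanceAs (Algebra ℂ (FreeAlgebra ℂ (X ⊕ X)))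

/-- The variable `x`. -/
noncomputable def var (x : X) : FreeStarAlgebra X := FreeAlgebra.ι ℂ (Sum.inl x)

/-- The adjoint as a ring homomorphism into the opposite ring: it is conjugate-linear and exchanges
`x` and `x⋆`. -/
noncomputable def adjointHom : FreeStarAlgebra X →+* (FreeStarAlgebra X)ᵐᵒᵖ :=
  letI : Algebra ℂ (FreeStarAlgebra X)ᵐᵒᵖ :=
    ((algebraMap ℂ (FreeStarAlgebra X)ᵐᵒᵖ).comp (starRingEnd ℂ)).toAlgebra'
      fun c x => Algebra.commutes (starRingEnd ℂ c) x
  (FreeAlgebra.lift ℂ fun x : X ⊕ X =>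
    (MulOpposite.op (FreeAlgebra.ι ℂ x.swap) : (FreeStarAlgebra X)ᵐᵒᵖ)).toRingHom

theorem adjointHom_ι (x : X ⊕ X) :
    adjointHom (FreeAlgebra.ι ℂ x : FreeStarAlgebra X) =
      MulOpposite.op (FreeAlgebra.ι ℂ x.swap : FreeStarAlgebra X) := by
  let _ : Algebra ℂ (FreeStarAlgebra X)ᵐᵒᵖ :=
    ((algebraMap ℂ (FreeStarAlgebra X)ᵐᵒᵖ).comp (starRingEnd ℂ)).toAlgebra'
      fun c x => Algebra.commutes (starRingEnd ℂ c) x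
  exact FreeAlgebra.lift_ι_apply _ _

theorem adjointHom_algebraMap (c : ℂ) :
    adjointHom (algebraMap ℂ (FreeStarAlgebra X) c) =
      MulOpposite.op (algebraMap ℂ (FreeStarAlgebra X) (starRingEnd ℂ c)) := by
  let _ : Algebra ℂ (FreeStarAlgebra X)ᵐᵒᵖ :=
    ((algebraMap ℂ (FreeStarAlgebra X)ᵐᵒᵖ).comp (starRingEnd ℂ)).toAlgebra'
      fun c x => Algebra.commutes (starRingEnd ℂ c) x
  exact AlgHom.commutes (FreeAlgebra.lift ℂ fun x : X ⊕ X =>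
    (MulOpposite.op (FreeAlgebra.ι ℂ x.swap) : (FreeStarAlgebra X)ᵐᵒᵖ)) c

theorem adjointHom_adjointHom (a : FreeStarAlgebra X) :
    (adjointHom (adjointHom a).unop).unop = a := by
  induction a using FreeAlgebra.induction with
  | grade0 c =>
    have h := adjointHom_algebraMap (X := X)
    erw [h, h]
    simp
    rfl
  | grade1 x =>
    erw [adjointHom_ι, adjointHom_ι]
    simp
    rfl
  | mul a b ha hb =>
    erw [map_mul, MulOpposite.unop_mul, map_mul, MulOpposite.unop_mul, ha, hb]
    rfl
  | add a b ha hb =>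
    erw [map_add, MulOpposite.unop_add, map_add, MulOpposite.unop_add, ha, hb]
    rfl

noncomputable instance : StarRing (FreeStarAlgebra X) where
  star a := (adjointHom a).unop
  star_involutive := adjointHom_adjointHom
  star_mul a b := by rw [map_mul, MulOpposite.unop_mul]
  star_add a b := by rw [map_add, MulOpposite.unop_add]

instance : StarModule ℂ (FreeStarAlgebra X) where
  star_smul c a := by
    change (adjointHom (c • a)).unop = star c • (adjointHom a).unop
    rw [Algebra.smul_def, map_mul, adjointHom_algebraMap, MulOpposite.unop_mul,
      MulOpposite.unop_op, ← Algebra.commutes, ← Algebra.smul_def]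
    rfl

end FreeStarAlgebra

/-! ### Magic unitaries -/

/-- The defining relations of magic unitaries, in an arbitrary unital `*`-ring: the coefficients are
self-adjoint idempotents, those of each row and of each column sum to `1`, and those of a common
row or of a common column are pairwise orthogonal. (In a nonzero complex algebra such a matrix is
necessarily square.) -/
structure IsMagicUnitary {V W A : Type*} [Fintype V] [Fintype W] [Ring A] [StarRing A]
    (P : Matrix W V A) : Prop where
  star_eq : ∀ i j, star (P i j) = P i j
  mul_self : ∀ i j, P i j * P i j = P i j
  row_sum : ∀ i, ∑ j, P i j = 1
  col_sum : ∀ j, ∑ i, P i j = 1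
  row_orthogonal : ∀ i j k, j ≠ k → P i j * P i k = 0
  col_orthogonal : ∀ i k j, i ≠ k → P i j * P k j = 0

/-! ### The quantum automorphism group of a graph -/

namespace QuantumAut

variable {V : Type u} [Fintype V] (G : SimpleGraph V)

/-- The matrix whose coefficients are the variables `x i j`. -/
noncomputable def varMatrix (V : Type u) : Matrix V V (FreeStarAlgebra (V × V)) :=
  Matrix.of fun i j => FreeStarAlgebra.var (i, j)

open Classical in
/-- The relations of the quantum automorphism group of `G`: those of a magic unitary, together with
the commutation with the adjacency matrix of `G`, and their adjoints. -/
inductive Rel : FreeStarAlgebra (V × V) → FreeStarAlgebra (V × V) → Prop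
  | star_eq (i j : V) : Rel (star (varMatrix V i j)) (varMatrix V i j)
  | mul_self (i j : V) : Rel (varMatrix V i j * varMatrix V i j) (varMatrix V i j)
  | row_sum (i : V) : Rel (∑ j, varMatrix V i j) 1
  | col_sum (j : V) : Rel (∑ i, varMatrix V i j) 1
  | row_orthogonal (i j k : V) (h : j ≠ k) : Rel (varMatrix V i j * varMatrix V i k) 0
  | col_orthogonal (i k j : V) (h : i ≠ k) : Rel (varMatrix V i j * varMatrix V k j) 0
  | adj_comm (i j : V) :
      Rel ((G.adjMatrix (FreeStarAlgebra (V × V)) * varMatrix V) i j)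
        ((varMatrix V * G.adjMatrix (FreeStarAlgebra (V × V))) i j)
  | adjoint (a b : FreeStarAlgebra (V × V)) (h : Rel a b) : Rel (star a) (star b)

end QuantumAut

/-- The `*`-algebra `𝒪(Qu(G))` of coefficients of the quantum automorphism group of `G`: the
universal unital complex `*`-algebra generated by the coefficients of a magic unitary that commutes
with the adjacency matrix of `G`. -/
def QuantumAut {V : Type u} [Fintype V] (G : SimpleGraph V) : Type u :=
  RingQuot (QuantumAut.Rel G)

namespace QuantumAut

variable {V : Type u} [Fintype V] (G : SimpleGraph V)

noncomputable instance : Ring (QuantumAut G) := inferInstanceAs (Ring (RingQuot (Rel G)))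

noncomputable instance : Algebra ℂ (QuantumAut G) :=
  inferInstanceAs (Algebra ℂ (RingQuot (Rel G)))

noncomputable instance : StarRing (QuantumAut G) := RingQuot.starRing (Rel G) Rel.adjoint

/-- The image of a noncommutative `*`-polynomial in `𝒪(Qu(G))`. -/
noncomputable def mk : FreeStarAlgebra (V × V) →ₐ[ℂ] QuantumAut G := RingQuot.mkAlgHom ℂ (Rel G)

theorem star_mk (a : FreeStarAlgebra (V × V)) : star (mk G a) = mk G (star a) := by
  simp only [mk, RingQuot.mkAlgHom_def, RingQuot.mkRingHom_def]
  rfl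

instance : StarModule ℂ (QuantumAut G) where
  star_smul c a := by
    obtain ⟨a, rfl⟩ := RingQuot.mkAlgHom_surjective ℂ (Rel G) a
    change star (c • mk G a) = star c • star (mk G a)
    rw [← map_smul, star_mk, star_mk, star_smul, map_smul]

end QuantumAut

namespace SimpleGraph

/-! ### Tree-cographs -/

/-- Tree-cographs: the smallest class of (isomorphism classes of) finite graphs that contains all
trees and is closed under disjoint sums and complements. -/
inductive IsTreeCograph : {V : Type u} → SimpleGraph V → Prop
  | tree {V : Type u} [Finite V] (G : SimpleGraph V) (hG : G.IsTree) : IsTreeCograph G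
  | sum {V W : Type u} (G : SimpleGraph V) (H : SimpleGraph W) (hG : IsTreeCograph G)
      (hH : IsTreeCograph H) : IsTreeCograph (G ⊕g H)
  | compl {V : Type u} (G : SimpleGraph V) (hG : IsTreeCograph G) : IsTreeCograph Gᶜ
  | iso {V W : Type u} (G : SimpleGraph V) (H : SimpleGraph W) (e : G ≃g H)
      (hG : IsTreeCograph G) : IsTreeCograph H

/-! ### Classical symmetry -/

/-- `G` is asymmetric: its only automorphism is the identity. -/
def IsAsymmetric {V : Type u} (G : SimpleGraph V) : Prop :=
  ∀ f : G ≃g G, f = RelIso.refl G.Adj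

/-- Schmidt's criterion: `G` has two nontrivial automorphisms with disjoint supports. -/
def SatisfiesSchmidtCriterion {V : Type u} (G : SimpleGraph V) : Prop :=
  ∃ f g : G ≃g G, f ≠ RelIso.refl G.Adj ∧ g ≠ RelIso.refl G.Adj ∧
    Disjoint {x | f x ≠ x} {x | g x ≠ x}

/-! ### Quantum symmetry and quantum isomorphism -/

/-- `G` is quantum asymmetric: its quantum automorphism group is trivial, that is, `𝒪(Qu(G))` is
isomorphic to `ℂ`. (Such an isomorphism automatically respects the comultiplications.) -/
def IsQuantumAsymmetric {V : Type u} [Fintype V] (G : SimpleGraph V) : Prop :=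
  Nonempty (QuantumAut G ≃⋆ₐ[ℂ] ℂ)

/-- `G` has quantum symmetry: the `*`-algebra `𝒪(Qu(G))` is not commutative. -/
def HasQuantumSymmetry {V : Type u} [Fintype V] (G : SimpleGraph V) : Prop :=
  ¬ ∀ a b : QuantumAut G, a * b = b * a

open Classical in
/-- `G` is quantum isomorphic to `H`: there is a magic unitary `P` with coefficients in a nonzero
unital C⋆-algebra such that `P * Adj(G) = Adj(H) * P`. -/
def IsQuantumIsomorphic {V W : Type u} [Fintype V] [Fintype W] (G : SimpleGraph V)
    (H : SimpleGraph W) : Prop :=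
  ∃ (X : Type w) (_ : CStarAlgebra X) (_ : Nontrivial X) (P : Matrix W V X),
    IsMagicUnitary P ∧ P * G.adjMatrix X = H.adjMatrix X * P

end SimpleGraph

universe v

/-! ### Quantum isomorphisms between pair colourings -/

section QuantumIso

open Classical

/-- A magic unitary `P`, relative to the unit `e`, that intertwines the pair colourings `R` and `R'`:
two entries `P i j` and `P k l` have a nonzero product only if `(i, k)` and `(j, l)` have the same
colour. -/
structure IsQuantumIso {K V W A : Type*} [Fintype V] [Fintype W] [Ring A] (R : V → V → K)
    (R' : W → W → K) (e : A) (P : W → V → A) : Prop where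
  mul_self : ∀ i j, P i j * P i j = P i j
  row_sum : ∀ i, ∑ j, P i j = e
  col_sum : ∀ j, ∑ i, P i j = e
  row_orth : ∀ i j l, j ≠ l → P i j * P i l = 0
  col_orth : ∀ i k j, i ≠ k → P i j * P k j = 0
  zero_comm : ∀ i j k l, P i j * P k l = 0 → P k l * P i j = 0
  color_eq : ∀ i j k l, P i j * P k l ≠ 0 → R' i k = R j l

/-- The equivalence `f` preserves the colours of all pairs. -/
def IsColorIso {K V W : Type*} (R : V → V → K) (R' : W → W → K) (f : V ≃ W) : Prop :=
  ∀ x y, R' (f x) (f y) = R x y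

/-- The restriction of a pair colouring to a subtype. -/
abbrev restrictColor {K V : Type*} (R : V → V → K) (p : V → Prop) :
    Subtype p → Subtype p → K := fun x y => R x y

/-- Every product of two nonzero entries of `P` respects the relations `ρ` and `ρ'`. -/
def Respects {V W A : Type*} [Ring A] (ρ : V → V → Prop) (ρ' : W → W → Prop) (P : W → V → A) :
    Prop :=
  ∀ i j k l, P i j * P k l ≠ 0 → (ρ' i k ↔ ρ j l)

namespace IsColorIso

variable {K U V W : Type*} {R₀ : U → U → K} {R : V → V → K} {R' : W → W → K}

theorem refl (R : V → V → K) : IsColorIso R R (Equiv.refl V) := fun _ _ => rfl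

theorem symm {f : V ≃ W} (hf : IsColorIso R R' f) : IsColorIso R' R f.symm := fun x y => by
  rw [← hf, f.apply_symm_apply, f.apply_symm_apply]

theorem trans {f : U ≃ V} {g : V ≃ W} (hf : IsColorIso R₀ R f) (hg : IsColorIso R R' g) :
    IsColorIso R₀ R' (f.trans g) := fun x y => by
  simp [hg _ _, hf _ _]

end IsColorIso

theorem SimpleGraph.exists_walk_length_succ {V : Type*} (G : SimpleGraph V) (n : ℕ) :
    (fun x y => ∃ p : G.Walk x y, p.length = n + 1) =
      Relation.Comp G.Adj (fun x y => ∃ p : G.Walk x y, p.length = n) := by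
  ext x y
  constructor
  · rintro ⟨p, hp⟩
    cases p with
    | nil => simp at hp
    | cons hxz q => exact ⟨_, hxz, q, by simpa using hp⟩
  · rintro ⟨z, hxz, q, hq⟩
    exact ⟨.cons hxz q, by simp [hq]⟩

namespace IsQuantumIso

variable {K : Type*} {V W U : Type*} {A : Type v} [Fintype V] [Fintype W] [Fintype U] [Ring A]
  {R : V → V → K} {R' : W → W → K} {e : A} {P : W → V → A}

theorem unit_mul (h : IsQuantumIso R R' e P) (i j) : e * P i j = P i j := by
  rw [← h.row_sum i, Finset.sum_mul, Finset.sum_eq_single j]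
  · exact h.mul_self i j
  · intro l _ hl
    exact h.row_orth i l j hl
  · simp

theorem mul_unit (h : IsQuantumIso R R' e P) (i j) : P i j * e = P i j := by
  rw [← h.row_sum i, Finset.mul_sum, Finset.sum_eq_single j]
  · exact h.mul_self i j
  · intro l _ hl
    exact h.row_orth i j l hl.symm
  · simp

theorem symm (h : IsQuantumIso R R' e P) : IsQuantumIso R' R e (fun j i => P i j) where
  mul_self i j := h.mul_self j i
  row_sum i := h.col_sum i
  col_sum j := h.row_sum j
  row_orth i j l := h.col_orth j l i
  col_orth i k j := h.row_orth j i k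
  zero_comm i j k l := h.zero_comm j i l k
  color_eq i j k l hne := (h.color_eq j i l k hne).symm

/-- Transport of the column index along a colour isomorphism. -/
theorem comp (h : IsQuantumIso R R' e P) {R₀ : U → U → K} {f : U ≃ V} (hf : IsColorIso R₀ R f) :
    IsQuantumIso R₀ R' e (fun i j => P i (f j)) where
  mul_self i j := h.mul_self _ _
  row_sum i := by rw [← h.row_sum i]; exact f.sum_comp (fun j => P i j)
  col_sum j := h.col_sum _
  row_orth i j l hjl := h.row_orth _ _ _ (f.injective.ne hjl)
  col_orth i k j := h.col_orth _ _ _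
  zero_comm i j k l := h.zero_comm _ _ _ _
  color_eq i j k l hne := (h.color_eq _ _ _ _ hne).trans (hf _ _)

theorem mul_ne_zero_comm (h : IsQuantumIso R R' e P) {i j k l} (hne : P i j * P k l ≠ 0) :
    P k l * P i j ≠ 0 := fun h0 => hne (h.zero_comm _ _ _ _ h0)

theorem exists_mul_mul_ne_zero (h : IsQuantumIso R R' e P) {i j k l} (hne : P i j * P k l ≠ 0)
    (m : W) : ∃ n, P i j * P m n ≠ 0 ∧ P m n * P k l ≠ 0 := by
  by_contra! hcon
  apply hne
  rw [← h.mul_unit i j, ← h.row_sum m, Finset.mul_sum, Finset.sum_mul]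
  refine Finset.sum_eq_zero fun n _ => ?_
  by_cases h0 : P i j * P m n = 0
  · rw [h0, zero_mul]
  · rw [mul_assoc, hcon n h0, mul_zero]

theorem exists_mul_ne_zero (h : IsQuantumIso R R' e P) {i j} (hne : P i j ≠ 0) (m : W) :
    ∃ n, P i j * P m n ≠ 0 := by
  rw [← h.mul_self] at hne
  obtain ⟨n, hn, -⟩ := h.exists_mul_mul_ne_zero hne m
  exact ⟨n, hn⟩

theorem exists_ne_zero (h : IsQuantumIso R R' e P) (he : e ≠ 0) (i : W) : ∃ j, P i j ≠ 0 := by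
  by_contra! hcon
  exact he (by rw [← h.row_sum i]; exact Finset.sum_eq_zero fun j _ => hcon j)

theorem color_diag (h : IsQuantumIso R R' e P) {i j} (hne : P i j ≠ 0) : R' i i = R j j :=
  h.color_eq i j i j (by rwa [h.mul_self])

theorem respects_color (h : IsQuantumIso R R' e P) (S : Set K) :
    Respects (fun x y => R x y ∈ S) (fun x y => R' x y ∈ S) P := fun i j k l hne => by
  simp only [h.color_eq i j k l hne]

theorem respects_eq (h : IsQuantumIso R R' e P) : Respects (· = ·) (· = ·) P := by
  intro i j k l hne
  constructor
  · rintro rfl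
    by_contra hjl
    exact hne (h.row_orth _ _ _ hjl)
  · rintro rfl
    by_contra hik
    exact hne (h.col_orth _ _ _ hik)

theorem respects_comp (h : IsQuantumIso R R' e P) {ρ σ : V → V → Prop} {ρ' σ' : W → W → Prop}
    (hρ : Respects ρ ρ' P) (hσ : Respects σ σ' P) :
    Respects (Relation.Comp ρ σ) (Relation.Comp ρ' σ') P := by
  intro i j k l hne
  constructor
  · rintro ⟨m, h1, h2⟩
    obtain ⟨n, hn1, hn2⟩ := h.exists_mul_mul_ne_zero hne m
    exact ⟨n, (hρ _ _ _ _ hn1).1 h1, (hσ _ _ _ _ hn2).1 h2⟩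
  · rintro ⟨m, h1, h2⟩
    obtain ⟨n, hn1, hn2⟩ := h.symm.exists_mul_mul_ne_zero hne m
    exact ⟨n, (hρ _ _ _ _ hn1).2 h1, (hσ _ _ _ _ hn2).2 h2⟩

theorem eqvGen_of_mul_ne_zero (h : IsQuantumIso R R' e P) {ρ : V → V → Prop}
    {ρ' : W → W → Prop} (hρ : Respects ρ ρ' P) {i k : W} (hik : Relation.EqvGen ρ' i k) :
    ∀ j l, P i j * P k l ≠ 0 → Relation.EqvGen ρ j l := by
  induction hik with
  | rel i k hik => exact fun j l hne => .rel _ _ ((hρ _ _ _ _ hne).1 hik)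
  | refl i =>
    intro j l hne
    rw [(h.respects_eq _ _ _ _ hne).1 rfl]
    exact .refl _
  | symm i k _ ih => exact fun j l hne => (ih _ _ (h.mul_ne_zero_comm hne)).symm
  | trans i m k _ _ ih1 ih2 =>
    intro j l hne
    obtain ⟨n, hn1, hn2⟩ := h.exists_mul_mul_ne_zero hne m
    exact (ih1 _ _ hn1).trans _ _ _ (ih2 _ _ hn2)

theorem respects_eqvGen (h : IsQuantumIso R R' e P) {ρ : V → V → Prop} {ρ' : W → W → Prop}
    (hρ : Respects ρ ρ' P) : Respects (Relation.EqvGen ρ) (Relation.EqvGen ρ') P :=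
  fun i j k l hne => ⟨fun hik => h.eqvGen_of_mul_ne_zero hρ hik j l hne, fun hjl =>
    h.symm.eqvGen_of_mul_ne_zero (fun a b c d hn => (hρ b a d c hn).symm) hjl i k hne⟩

theorem respects_walk_length (h : IsQuantumIso R R' e P) {G : SimpleGraph V} {H : SimpleGraph W}
    (hadj : Respects G.Adj H.Adj P) (n : ℕ) :
    Respects (fun x y => ∃ p : G.Walk x y, p.length = n)
      (fun x y => ∃ p : H.Walk x y, p.length = n) P := by
  induction n with
  | zero =>
    convert h.respects_eq using 3 with x y x y <;>
    · refine ⟨fun ⟨p, hp⟩ => p.eq_of_length_eq_zero hp, ?_⟩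
      rintro rfl
      exact ⟨.nil, rfl⟩
  | succ n ih =>
    simp only [SimpleGraph.exists_walk_length_succ]
    exact h.respects_comp hadj ih

theorem respects_dist (h : IsQuantumIso R R' e P) {G : SimpleGraph V} {H : SimpleGraph W}
    (hadj : Respects G.Adj H.Adj P) {i j k l} (hne : P i j * P k l ≠ 0) :
    H.dist i k = G.dist j l := by
  have hset : Set.range (SimpleGraph.Walk.length : H.Walk i k → ℕ) =
      Set.range (SimpleGraph.Walk.length : G.Walk j l → ℕ) :=
    Set.ext fun n => h.respects_walk_length hadj n _ _ _ _ hne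
  rw [SimpleGraph.dist_eq_sInf, SimpleGraph.dist_eq_sInf, hset]

/-! ### Block sums -/

section Blocks

variable {I I' : Type*} {π : V → I} {π' : W → I'}

theorem sum_block (h : IsQuantumIso R R' e P)
    (hπ : Respects (fun x y => π x = π y) (fun x y => π' x = π' y) P) (i : W) (j : V) :
    ∑ l with π l = π j, P i l = ∑ k with π' k = π' i, P k j := by
  have h1 : ∀ l, π l = π j → P i l = ∑ k with π' k = π' i, P i l * P k j := by
    intro l hl
    conv_lhs => rw [← h.mul_unit i l, ← h.col_sum j, Finset.mul_sum]
    rw [Finset.sum_filter]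
    refine Finset.sum_congr rfl fun k _ => ?_
    split_ifs with hk
    · rfl
    · by_contra hne
      exact hk ((hπ _ _ _ _ hne).2 hl).symm
  have h2 : ∀ k, π' k = π' i → P k j = ∑ l with π l = π j, P i l * P k j := by
    intro k hk
    conv_lhs => rw [← h.unit_mul k j, ← h.row_sum i, Finset.sum_mul]
    rw [Finset.sum_filter]
    refine Finset.sum_congr rfl fun l _ => ?_
    split_ifs with hl
    · rfl
    · by_contra hne
      exact hl ((hπ _ _ _ _ hne).1 hk.symm)
  rw [Finset.sum_congr rfl fun l hl => h1 l (Finset.mem_filter.1 hl).2,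
    Finset.sum_congr rfl fun k hk => h2 k (Finset.mem_filter.1 hk).2, Finset.sum_comm]

/-- The sum of the entries of a row of `P` over a block of columns. -/
noncomputable def blockSum (π : V → I) (P : W → V → A) (i : W) (a : I) : A :=
  ∑ l with π l = a, P i l

theorem blockSum_eq_col (h : IsQuantumIso R R' e P)
    (hπ : Respects (fun x y => π x = π y) (fun x y => π' x = π' y) P) (i : W) (j : V) :
    blockSum π P i (π j) = ∑ k with π' k = π' i, P k j :=
  h.sum_block hπ i j

theorem blockSum_congr (h : IsQuantumIso R R' e P)
    (hπ : Respects (fun x y => π x = π y) (fun x y => π' x = π' y) P) {i k : W}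
    (hik : π' i = π' k) (j : V) : blockSum π P i (π j) = blockSum π P k (π j) := by
  rw [h.blockSum_eq_col hπ, h.blockSum_eq_col hπ, hik]

theorem mul_blockSum (h : IsQuantumIso R R' e P) (i : W) (j : V) :
    P i j * blockSum π P i (π j) = P i j := by
  rw [blockSum, Finset.mul_sum, Finset.sum_eq_single_of_mem j (by simp)
    fun l _ hl => h.row_orth i j l hl.symm, h.mul_self]

theorem blockSum_ne_zero (h : IsQuantumIso R R' e P) {i : W} {j : V} (hne : P i j ≠ 0) :
    blockSum π P i (π j) ≠ 0 := fun h0 => hne (by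
  rw [← h.mul_blockSum (π := π), h0, mul_zero])

/-- A block of a quantum isomorphism is a quantum isomorphism relative to the block sum. -/
theorem restrict (h : IsQuantumIso R R' e P)
    (hπ : Respects (fun x y => π x = π y) (fun x y => π' x = π' y) P) {i₀ : W} {b : I'}
    (hb : π' i₀ = b) {j₀ : V} {a : I} (ha : π j₀ = a) :
    IsQuantumIso (restrictColor R (π · = a)) (restrictColor R' (π' · = b)) (blockSum π P i₀ a)
      (fun i j => P i j) where
  mul_self i j := h.mul_self i j
  row_sum i := by
    subst ha hb
    rw [← h.blockSum_congr hπ i.2, blockSum]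
    exact (Finset.sum_subtype (p := fun l => π l = π j₀) _ (by simp) (fun l => P i l)).symm
  col_sum j := by
    subst ha hb
    have hj : blockSum π P i₀ (π j₀) = blockSum π P i₀ (π j) := by rw [j.2]
    rw [hj, h.blockSum_eq_col hπ]
    exact (Finset.sum_subtype (p := fun l => π' l = π' i₀) _ (by simp) (fun l => P l j)).symm
  row_orth i j l hjl := h.row_orth _ _ _ (Subtype.coe_injective.ne hjl)
  col_orth i k j hik := h.col_orth _ _ _ (Subtype.coe_injective.ne hik)
  zero_comm i j k l := h.zero_comm _ _ _ _
  color_eq i j k l := h.color_eq _ _ _ _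

/-- The block sums form a magic unitary indexed by the blocks. -/
theorem quotient [Fintype I] [Fintype I'] (h : IsQuantumIso R R' e P)
    (hπ : Respects (fun x y => π x = π y) (fun x y => π' x = π' y) P)
    {r : I → V} (hr : ∀ a, π (r a) = a) {r' : I' → W} (hr' : ∀ b, π' (r' b) = b) :
    IsQuantumIso (fun _ _ : I => ()) (fun _ _ : I' => ()) e
      (fun b a => blockSum π P (r' b) a) where
  mul_self b a := by
    conv_lhs => enter [1]; rw [blockSum]
    rw [Finset.sum_mul]
    refine Finset.sum_congr rfl fun l hl => ?_
    rw [← (Finset.mem_filter.1 hl).2, h.mul_blockSum]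
  row_sum b := by
    rw [← h.row_sum (r' b)]
    exact Finset.sum_fiberwise _ _ _
  col_sum a := by
    have : ∀ b, blockSum π P (r' b) a = ∑ k with π' k = b, P k (r a) := fun b => by
      conv_lhs => rw [← hr a, h.blockSum_eq_col hπ, hr']
    simp only [this]
    rw [← h.col_sum (r a)]
    exact Finset.sum_fiberwise _ _ _
  row_orth b a a' hne := by
    simp only [blockSum, Finset.sum_mul, Finset.mul_sum]
    refine Finset.sum_eq_zero fun l hl => Finset.sum_eq_zero fun l' hl' => h.row_orth _ _ _ ?_
    rintro rfl
    exact hne ((Finset.mem_filter.1 hl').2.symm.trans (Finset.mem_filter.1 hl).2)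
  col_orth b b' a hne := by
    rw [← hr a, h.blockSum_eq_col hπ, h.blockSum_eq_col hπ]
    simp only [Finset.sum_mul, Finset.mul_sum]
    refine Finset.sum_eq_zero fun l hl => Finset.sum_eq_zero fun l' hl' => h.col_orth _ _ _ ?_
    rintro rfl
    simp only [hr', Finset.mem_filter] at hl hl'
    exact hne (by rw [← hl.2, ← hl'.2])
  zero_comm b a b' a' h0 := by
    have hz : ∀ l l', π l = a → π l' = a' → P (r' b') l' * P (r' b) l = 0 := by
      rintro l l' rfl rfl
      refine h.zero_comm _ _ _ _ ?_
      have hb : blockSum π P (r' b') (π l') * P (r' b') l' = P (r' b') l' := by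
        rw [blockSum, Finset.sum_mul, Finset.sum_eq_single_of_mem l' (by simp)
          fun x _ hx => h.row_orth _ x l' hx, h.mul_self]
      rw [← h.mul_blockSum (π := π) (r' b) l, ← hb, mul_assoc, ← mul_assoc (blockSum _ _ _ _), h0,
        zero_mul, mul_zero]
    simp only [blockSum, Finset.sum_mul, Finset.mul_sum]
    exact Finset.sum_eq_zero fun l hl => Finset.sum_eq_zero fun l' hl' =>
      hz _ _ (Finset.mem_filter.1 hl).2 (Finset.mem_filter.1 hl').2
  color_eq _ _ _ _ _ := rfl

end Blocks

/-- Nonzero entries join points of equal label only, hence some bijection preserves the labels. -/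
theorem exists_equiv_of_label [IsAddTorsionFree A] (h : IsQuantumIso R R' e P) (he : e ≠ 0)
    {Γ : Type*} (f : V → Γ) (g : W → Γ) (hfg : ∀ i j, P i j ≠ 0 → g i = f j) :
    ∃ τ : V ≃ W, ∀ x, g (τ x) = f x := by
  have hcard : ∀ c, Fintype.card {x // f x = c} = Fintype.card {y // g y = c} := by
    intro c
    have h1 : ∀ j, f j = c → ∑ i with g i = c, P i j = e := by
      intro j hj
      rw [← h.col_sum j, Finset.sum_filter]
      refine Finset.sum_congr rfl fun i _ => ?_
      split_ifs with hi
      · rfl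
      · by_contra hne
        exact hi ((hfg i j (Ne.symm hne)).trans hj)
    have h2 : ∀ i, g i = c → ∑ j with f j = c, P i j = e := by
      intro i hi
      rw [← h.row_sum i, Finset.sum_filter]
      refine Finset.sum_congr rfl fun j _ => ?_
      split_ifs with hj
      · rfl
      · by_contra hne
        exact hj ((hfg i j (Ne.symm hne)).symm.trans hi)
    have h3 : ∑ j with f j = c, ∑ i with g i = c, P i j =
        ∑ i with g i = c, ∑ j with f j = c, P i j := Finset.sum_comm
    rw [Finset.sum_congr rfl fun j hj => h1 j (Finset.mem_filter.1 hj).2,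
      Finset.sum_congr rfl fun i hi => h2 i (Finset.mem_filter.1 hi).2, Finset.sum_const,
      Finset.sum_const] at h3
    rw [Fintype.card_subtype, Fintype.card_subtype]
    by_contra hne
    rcases lt_or_gt_of_ne hne with hlt | hlt
    · obtain ⟨d, hd⟩ := Nat.exists_eq_add_of_lt hlt
      rw [hd, add_assoc, add_nsmul, left_eq_add] at h3
      exact he ((nsmul_eq_zero_iff_right (Nat.succ_ne_zero d)).1 h3)
    · obtain ⟨d, hd⟩ := Nat.exists_eq_add_of_lt hlt
      rw [hd, add_assoc, add_nsmul, add_eq_left] at h3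
      exact he ((nsmul_eq_zero_iff_right (Nat.succ_ne_zero d)).1 h3)
  exact ⟨Equiv.ofFiberEquiv fun c => Fintype.equivOfCardEq (hcard c),
    fun x => Equiv.ofFiberEquiv_map _ x⟩

/-- If two pairs of distinct related indices always meet, then a magic unitary whose nonzero entries
join related indices only has commuting entries. -/
theorem commute_of_pairs_meet {R R' : V → V → K} {P : V → V → A} (h : IsQuantumIso R R' e P)
    {ρ : V → V → Prop} (hρ : Equivalence ρ) (hP : ∀ i j, P i j ≠ 0 → ρ i j)
    (hmeet : ∀ a b c d, a ≠ b → ρ a b → c ≠ d → ρ c d → a = c ∨ a = d ∨ b = c ∨ b = d)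
    (i j k l : V) : Commute (P i j) (P k l) := by
  have hsingle : ∀ a, (∀ b, ρ a b → a = b) → ∀ b, P a b = 0 ∨ P a b = e := by
    intro a ha b
    by_cases hab : P a b = 0
    · exact .inl hab
    · right
      rw [← h.row_sum a, Finset.sum_eq_single b]
      · intro c _ hc
        by_contra hne
        exact hc ((ha c (hP _ _ hne)).symm.trans (ha b (hP _ _ hab)))
      · simp
  have hcomm : ∀ a, (∀ b, ρ a b → a = b) → ∀ b c d, Commute (P a b) (P c d) := by
    intro a ha b c d
    rcases hsingle a ha b with h0 | h0
    · rw [h0]; exact Commute.zero_left _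
    · rw [h0]; exact (h.unit_mul c d).trans (h.mul_unit c d).symm
  by_cases hi : ∀ b, ρ i b → i = b
  · exact hcomm i hi _ _ _
  by_cases hk : ∀ b, ρ k b → k = b
  · exact (hcomm k hk _ _ _).symm
  push Not at hi hk
  by_cases hij : P i j = 0
  · rw [hij]; exact Commute.zero_left _
  by_cases hkl : P k l = 0
  · rw [hkl]; exact Commute.zero_right _
  rcases eq_or_ne i k with rfl | hik
  · rcases eq_or_ne j l with rfl | hjl
    · exact Commute.refl _
    · exact (h.row_orth _ _ _ hjl).trans (h.row_orth _ _ _ hjl.symm).symm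
  rcases eq_or_ne j l with rfl | hjl
  · exact (h.col_orth _ _ _ hik).trans (h.col_orth _ _ _ hik.symm).symm
  have hρik : ρ i k := by
    obtain ⟨b, hb, hib⟩ := hi
    obtain ⟨d, hd, hkd⟩ := hk
    rcases hmeet i b k d hib hb hkd hd with h1 | h1 | h1 | h1
    · exact absurd h1 hik
    · rw [h1]; exact hρ.symm hd
    · rw [← h1]; exact hb
    · exact hρ.trans hb (h1 ▸ hρ.symm hd)
  have hρij := hP _ _ hij
  have hρkl := hP _ _ hkl
  have hρjl : ρ j l := hρ.trans (hρ.symm hρij) (hρ.trans hρik hρkl)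
  have key : ∀ m, m ≠ j → P i j * P k l * P i m = 0 ∧ P i m * P k l * P i j = 0 := by
    intro m hmj
    rcases eq_or_ne m l with rfl | hml
    · exact ⟨by rw [mul_assoc, h.col_orth _ _ _ hik.symm, mul_zero],
        by rw [h.col_orth _ _ _ hik, zero_mul]⟩
    have hne : ∀ n, n ≠ l → P i j * P k n * P i m = 0 ∧ P i m * P k n * P i j = 0 := by
      intro n hnl
      rcases eq_or_ne n j with rfl | hnj
      · exact ⟨by rw [h.col_orth _ _ _ hik, zero_mul],
          by rw [mul_assoc, h.col_orth _ _ _ hik.symm, mul_zero]⟩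
      rcases eq_or_ne n m with rfl | hnm
      · exact ⟨by rw [mul_assoc, h.col_orth _ _ _ hik.symm, mul_zero],
          by rw [h.col_orth _ _ _ hik, zero_mul]⟩
      have h0 : P i m = 0 ∨ P k n = 0 := by
        by_contra! hcon
        have hmn : ρ m n :=
          hρ.trans (hρ.symm (hP _ _ hcon.1)) (hρ.trans hρik (hP _ _ hcon.2))
        rcases hmeet j l m n hjl hρjl hnm.symm hmn with h1 | h1 | h1 | h1
        · exact hmj h1.symm
        · exact hnj h1.symm
        · exact hml h1.symm
        · exact hnl h1.symm
      rcases h0 with h0 | h0 <;> simp [h0]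
    have e1 : P i j * e * P i m = P i j * P k l * P i m := by
      rw [← h.row_sum k, Finset.mul_sum, Finset.sum_mul, Finset.sum_eq_single l]
      · exact fun n _ hn => (hne n hn).1
      · simp
    have e2 : P i m * e * P i j = P i m * P k l * P i j := by
      rw [← h.row_sum k, Finset.mul_sum, Finset.sum_mul, Finset.sum_eq_single l]
      · exact fun n _ hn => (hne n hn).2
      · simp
    rw [h.mul_unit, h.row_orth _ _ _ hmj.symm] at e1
    rw [h.mul_unit, h.row_orth _ _ _ hmj] at e2
    exact ⟨e1.symm, e2.symm⟩
  have e1 : P i j * P k l = P i j * P k l * P i j := by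
    conv_lhs => rw [← h.mul_unit k l, ← h.row_sum i, ← mul_assoc, Finset.mul_sum]
    rw [Finset.sum_eq_single j]
    · exact fun m _ hm => (key m hm).1
    · simp
  have e2 : P k l * P i j = P i j * P k l * P i j := by
    conv_lhs => rw [← h.unit_mul k l, ← h.row_sum i, mul_assoc, Finset.sum_mul]
    rw [Finset.sum_eq_single j]
    · rw [mul_assoc]
    · intro m _ hm
      rw [← mul_assoc]
      exact (key m hm).2
    · simp
  exact e1.trans e2.symm

end IsQuantumIso

end QuantumIso

/-! ### Tractable pair colourings -/

section Tractable

open Classical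

/-- The identity is the only automorphism of `R`. -/
def IsColorAsymmetric {K V : Type*} (R : V → V → K) : Prop :=
  ∀ f : Equiv.Perm V, IsColorIso R R f → f = 1

/-- `R` has two nontrivial automorphisms with disjoint supports. -/
def HasDisjointAutomorphisms {K V : Type*} (R : V → V → K) : Prop :=
  ∃ f g : Equiv.Perm V, IsColorIso R R f ∧ IsColorIso R R g ∧ f ≠ 1 ∧ g ≠ 1 ∧ f.Disjoint g

/-- Over the coefficient ring `A`, the quantum isomorphisms from `R` are controlled by the
isomorphisms from `R`. -/
structure IsTractable {K : Type*} {V : Type u} [Fintype V] (A : Type v) [Ring A]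
    (R : V → V → K) : Prop where
  rigid : ∀ (W : Type u) [Fintype W] (R' : W → W → K) (e : A) (P : W → V → A), e ≠ 0 →
    IsQuantumIso R R' e P → ∃ f : V ≃ W, IsColorIso R R' f
  asymm : IsColorAsymmetric R → ∀ (e : A) (P : V → V → A), IsQuantumIso R R e P →
    ∀ i j, i ≠ j → P i j = 0
  comm : ¬ HasDisjointAutomorphisms R → ∀ (e : A) (P : V → V → A), IsQuantumIso R R e P →
    ∀ i j k l, Commute (P i j) (P k l)

theorem IsColorIso.of_blocks {K V W I I' : Type*} {R : V → V → K} {R' : W → W → K} {π : V → I}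
    {π' : W → I'} {φ : K → K → K} (hR : ∀ x y, π x ≠ π y → R x y = φ (R x x) (R y y))
    (hR' : ∀ x y, π' x ≠ π' y → R' x y = φ (R' x x) (R' y y)) (f : V ≃ W)
    (hne : ∀ x y, π x ≠ π y → π' (f x) ≠ π' (f y))
    (hf : ∀ x y, π x = π y → R' (f x) (f y) = R x y) : IsColorIso R R' f := by
  intro x y
  by_cases h : π x = π y
  · exact hf x y h
  · rw [hR' _ _ (hne x y h), hR x y h, hf x x rfl, hf y y rfl]

section Extension

variable {K V I : Type*} {R : V → V → K} {π : V → I} {φ : K → K → K}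

theorem IsColorIso.ofSubtype (hR : ∀ x y, π x ≠ π y → R x y = φ (R x x) (R y y)) {a : I}
    {g : Equiv.Perm {x // π x = a}}
    (hg : IsColorIso (restrictColor R (π · = a)) (restrictColor R (π · = a)) g) :
    IsColorIso R R (Equiv.Perm.ofSubtype g) := by
  have hπ : ∀ x, π (Equiv.Perm.ofSubtype g x) = π x := by
    intro x
    by_cases hx : π x = a
    · rw [Equiv.Perm.ofSubtype_apply_of_mem g hx, (g ⟨x, hx⟩).2, hx]
    · rw [Equiv.Perm.ofSubtype_apply_of_not_mem g hx]
  refine .of_blocks hR hR _ (fun x y h => by rwa [hπ, hπ]) fun x y h => ?_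
  by_cases hx : π x = a
  · have hy : π y = a := h ▸ hx
    rw [Equiv.Perm.ofSubtype_apply_of_mem g hx, Equiv.Perm.ofSubtype_apply_of_mem g hy]
    exact hg ⟨x, hx⟩ ⟨y, hy⟩
  · have hy : ¬ π y = a := h ▸ hx
    rw [Equiv.Perm.ofSubtype_apply_of_not_mem g hx, Equiv.Perm.ofSubtype_apply_of_not_mem g hy]

theorem Equiv.Perm.ofSubtype_ne_one {p : V → Prop} {g : Equiv.Perm (Subtype p)} (hg : g ≠ 1) :
    Equiv.Perm.ofSubtype g ≠ 1 := fun h =>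
  hg (Equiv.Perm.ofSubtype_injective (h.trans (map_one _).symm))

/-- Isomorphic blocks can be swapped. -/
theorem exists_swap_blocks (hR : ∀ x y, π x ≠ π y → R x y = φ (R x x) (R y y)) {a b : I}
    (hab : a ≠ b) {F : {x // π x = a} ≃ {x // π x = b}}
    (hF : IsColorIso (restrictColor R (π · = a)) (restrictColor R (π · = b)) F) :
    ∃ σ : Equiv.Perm V, IsColorIso R R σ ∧ (∀ x, π (σ x) = Equiv.swap a b (π x)) ∧
      ∀ x, π x ≠ a → π x ≠ b → σ x = x := by
  let s : V → V := fun x => if ha : π x = a then F ⟨x, ha⟩ else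
    if hb : π x = b then F.symm ⟨x, hb⟩ else x
  have sa : ∀ x (h : π x = a), s x = F ⟨x, h⟩ := fun x h => by simp [s, h]
  have sb : ∀ x (h : π x = b), s x = F.symm ⟨x, h⟩ := fun x h => by
    have : π x ≠ a := fun h' => hab (h'.symm.trans h)
    simp [s, h, hab.symm]
  have sc : ∀ x, π x ≠ a → π x ≠ b → s x = x := fun x h h' => by simp [s, h, h']
  have hπ : ∀ x, π (s x) = Equiv.swap a b (π x) := by
    intro x
    by_cases ha : π x = a
    · rw [sa x ha, ha, Equiv.swap_apply_left, (F ⟨x, ha⟩).2]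
    by_cases hb : π x = b
    · rw [sb x hb, hb, Equiv.swap_apply_right, (F.symm ⟨x, hb⟩).2]
    · rw [sc x ha hb, Equiv.swap_apply_of_ne_of_ne ha hb]
  have hs : Function.Involutive s := by
    intro x
    by_cases ha : π x = a
    · rw [sa x ha, sb _ (F ⟨x, ha⟩).2, Subtype.coe_eta, F.symm_apply_apply]
    by_cases hb : π x = b
    · rw [sb x hb, sa _ (F.symm ⟨x, hb⟩).2, Subtype.coe_eta, F.apply_symm_apply]
    · rw [sc x ha hb, sc x ha hb]
  refine ⟨hs.toPerm, .of_blocks hR hR _ (fun x y h => ?_) fun x y h => ?_, hπ, sc⟩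
  · simpa [hπ] using h
  · simp only [Function.Involutive.coe_toPerm]
    by_cases ha : π x = a
    · have ha' : π y = a := h ▸ ha
      rw [sa x ha, sa y ha']
      exact hF ⟨x, ha⟩ ⟨y, ha'⟩
    by_cases hb : π x = b
    · have hb' : π y = b := h ▸ hb
      rw [sb x hb, sb y hb']
      exact hF.symm ⟨x, hb⟩ ⟨y, hb'⟩
    · rw [sc x ha hb, sc y (h ▸ ha) (h ▸ hb)]

end Extension

theorem IsTractable.restrict_congr {K : Type*} {V : Type u} {A : Type v} [Ring A]
    {R : V → V → K} {p q : V → Prop} [Fintype (Subtype p)] [Fintype (Subtype q)]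
    (h : IsTractable A (restrictColor R p)) (hpq : ∀ x, p x ↔ q x) :
    IsTractable A (restrictColor R q) := by
  obtain rfl : p = q := funext fun x => propext (hpq x)
  convert h

namespace IsTractable

variable {K : Type*} {V I : Type u} {A : Type v} [Fintype V] [Ring A] {R : V → V → K} {π : V → I} {φ : K → K → K}

theorem exists_colorIso_of_blocks [Fintype I] [IsAddTorsionFree A]
    (hR : ∀ x y, π x ≠ π y → R x y = φ (R x x) (R y y))
    (hπ : Function.Surjective π)
    (hB : ∀ a, IsTractable A (restrictColor R (π · = a)))
    {W I' : Type u} [Fintype W] [Fintype I'] {R' : W → W → K} {π' : W → I'}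
    (hπ' : Function.Surjective π') {e : A} {P : W → V → A} (he : e ≠ 0)
    (h : IsQuantumIso R R' e P)
    (hresp : Respects (fun x y => π x = π y) (fun x y => π' x = π' y) P) :
    ∃ f : V ≃ W, IsColorIso R R' f := by
  have hR' : ∀ x y, π' x ≠ π' y → R' x y = φ (R' x x) (R' y y) := by
    intro x y hxy
    obtain ⟨j, hj⟩ := h.exists_ne_zero he x
    obtain ⟨l, hl⟩ := h.exists_mul_ne_zero hj y
    rw [h.color_eq _ _ _ _ hl, h.color_diag hj, h.color_diag (right_ne_zero_of_mul hl)]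
    exact hR _ _ fun hjl => hxy ((hresp _ _ _ _ hl).2 hjl)
  have hr := Function.surjInv_eq hπ
  have hr' := Function.surjInv_eq hπ'
  let T : I → I' → Prop := fun a b => ∃ F : {x // π x = a} ≃ {y // π' y = b},
    IsColorIso (restrictColor R (π · = a)) (restrictColor R' (π' · = b)) F
  let T' : I' → I' → Prop := fun b c => ∃ F : {y // π' y = b} ≃ {y // π' y = c},
    IsColorIso (restrictColor R' (π' · = b)) (restrictColor R' (π' · = c)) F
  obtain ⟨τ, hτ⟩ := (h.quotient hresp hr hr').exists_equiv_of_label he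
    (fun a => {b | T a b}) (fun b => {c | T' b c}) fun b a hq => by
      obtain ⟨F, hF⟩ := (hB a).rigid _ _ _ _ hq (h.restrict hresp (hr' b) (hr a))
      ext c
      constructor
      · rintro ⟨F', hF'⟩
        exact ⟨F.trans F', hF.trans hF'⟩
      · rintro ⟨F', hF'⟩
        exact ⟨F.symm.trans F', hF.symm.trans hF'⟩
  have hT : ∀ a, T a (τ a) := fun a => by
    have : τ a ∈ {c | T' (τ a) c} := ⟨Equiv.refl _, .refl _⟩
    rwa [hτ a] at this
  choose F hF using hT
  let f : V ≃ W := (Equiv.sigmaFiberEquiv π).symm.trans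
    ((Equiv.sigmaCongr τ F).trans (Equiv.sigmaFiberEquiv π'))
  have hf : ∀ x a (hx : π x = a), f x = F a ⟨x, hx⟩ := by
    rintro x a rfl
    rfl
  have hfπ : ∀ x, π' (f x) = τ (π x) := fun x => by rw [hf x _ rfl]; exact (F _ _).2
  refine ⟨f, .of_blocks hR hR' f (fun x y hxy => ?_) fun x y hxy => ?_⟩
  · rw [hfπ, hfπ]
    exact τ.injective.ne hxy
  · rw [hf x (π y) hxy, hf y _ rfl]
    exact hF _ _ _

theorem asymm_of_blocks (hR : ∀ x y, π x ≠ π y → R x y = φ (R x x) (R y y))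
    (hB : ∀ a, IsTractable A (restrictColor R (π · = a))) (hasymm : IsColorAsymmetric R)
    {e : A} {P : V → V → A} (h : IsQuantumIso R R e P)
    (hresp : Respects (fun x y => π x = π y) (fun x y => π x = π y) P) (i j : V) (hij : i ≠ j) :
    P i j = 0 := by
  by_contra hne
  have hres := h.restrict hresp (rfl : π i = π i) (rfl : π j = π j)
  by_cases hπ : π i = π j
  · have hres' := h.restrict hresp hπ (rfl : π j = π j)
    refine hne ((hB (π j)).asymm (fun g hg => ?_) _ _ hres' ⟨i, hπ⟩ ⟨j, rfl⟩ (by simpa using hij))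
    by_contra hg1
    exact Equiv.Perm.ofSubtype_ne_one hg1 (hasymm _ (hg.ofSubtype hR))
  · obtain ⟨F, hF⟩ := (hB (π j)).rigid _ _ _ _ (h.blockSum_ne_zero hne) hres
    obtain ⟨σ, hσ, hσπ, -⟩ := exists_swap_blocks hR (Ne.symm hπ) hF
    have := hσπ j
    rw [hasymm σ hσ, Equiv.swap_apply_left] at this
    exact hπ this.symm

theorem comm_of_blocks [Fintype I]
    (hR : ∀ x y, π x ≠ π y → R x y = φ (R x x) (R y y))
    (hπ : Function.Surjective π)
    (hB : ∀ a, IsTractable A (restrictColor R (π · = a)))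
    (hdis : ¬ HasDisjointAutomorphisms R) {e : A} {P : V → V → A} (h : IsQuantumIso R R e P)
    (hresp : Respects (fun x y => π x = π y) (fun x y => π x = π y) P) (i j k l : V) :
    Commute (P i j) (P k l) := by
  let T : I → I → Prop := fun a b => ∃ F : {x // π x = a} ≃ {x // π x = b},
    IsColorIso (restrictColor R (π · = a)) (restrictColor R (π · = b)) F
  have hT : Equivalence T := ⟨fun a => ⟨_, .refl _⟩, fun ⟨F, hF⟩ => ⟨_, hF.symm⟩,
    fun ⟨F, hF⟩ ⟨F', hF'⟩ => ⟨_, hF.trans hF'⟩⟩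
  have hPT : ∀ i j, P i j ≠ 0 → T (π i) (π j) := fun i j hne =>
    hT.symm ((hB (π j)).rigid _ _ _ _ (h.blockSum_ne_zero hne)
      (h.restrict hresp (rfl : π i = π i) (rfl : π j = π j)))
  have hr := Function.surjInv_eq hπ
  have hswap : ∀ a b, a ≠ b → T a b → ∃ σ : Equiv.Perm V, IsColorIso R R σ ∧ σ ≠ 1 ∧
      ∀ x, π x ≠ a → π x ≠ b → σ x = x := by
    rintro a b hab ⟨F, hF⟩
    obtain ⟨σ, hσ, hσπ, hσ'⟩ := exists_swap_blocks hR hab hF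
    refine ⟨σ, hσ, ?_, hσ'⟩
    rintro rfl
    obtain ⟨x, rfl⟩ := hπ a
    have := hσπ x
    rw [Equiv.swap_apply_left] at this
    exact hab this
  have hasymm_of : ∀ a, ¬ IsColorAsymmetric (restrictColor R (π · = a)) →
      ∃ σ : Equiv.Perm V, IsColorIso R R σ ∧ σ ≠ 1 ∧ ∀ x, π x ≠ a → σ x = x := by
    intro a ha
    simp only [IsColorAsymmetric, not_forall] at ha
    obtain ⟨g, hg, hg1⟩ := ha
    exact ⟨_, hg.ofSubtype hR, Equiv.Perm.ofSubtype_ne_one hg1,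
      fun x hx => Equiv.Perm.ofSubtype_apply_of_not_mem g hx⟩
  have hmeet : ∀ a b c d, a ≠ b → T a b → c ≠ d → T c d →
      a = c ∨ a = d ∨ b = c ∨ b = d := by
    intro a b c d hab hTab hcd hTcd
    by_contra! hcon
    obtain ⟨σ, hσ, hσ1, hσ'⟩ := hswap a b hab hTab
    obtain ⟨ρ, hρ, hρ1, hρ'⟩ := hswap c d hcd hTcd
    refine hdis ⟨σ, ρ, hσ, hρ, hσ1, hρ1, fun x => ?_⟩
    by_cases hx : π x = a ∨ π x = b
    · right
      refine hρ' x ?_ ?_ <;> rcases hx with hx | hx <;> rw [hx] <;> tauto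
    · left
      push Not at hx
      exact hσ' x hx.1 hx.2
  have htwo : ∀ a b, a ≠ b → ¬ IsColorAsymmetric (restrictColor R (π · = a)) →
      IsColorAsymmetric (restrictColor R (π · = b)) := by
    intro a b hab ha
    by_contra hb
    obtain ⟨σ, hσ, hσ1, hσ'⟩ := hasymm_of a ha
    obtain ⟨ρ, hρ, hρ1, hρ'⟩ := hasymm_of b hb
    refine hdis ⟨σ, ρ, hσ, hρ, hσ1, hρ1, fun x => ?_⟩
    by_cases hx : π x = a
    · exact .inr (hρ' x (by rwa [hx]))
    · exact .inl (hσ' x hx)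
  have hasymm_iso : ∀ a b, T a b → IsColorAsymmetric (restrictColor R (π · = a)) →
      IsColorAsymmetric (restrictColor R (π · = b)) := by
    rintro a b ⟨F, hF⟩ ha g hg
    have := ha (F.trans (g.trans F.symm)) (hF.trans (hg.trans hF.symm))
    ext x
    have hx := congrArg (fun p => F (p (F.symm x))) this
    simpa using congrArg Subtype.val hx
  have hentry : ∀ i j, IsColorAsymmetric (restrictColor R (π · = π j)) →
      P i j = 0 ∨ P i j = IsQuantumIso.blockSum π P i (π j) := by
    intro i j hj
    by_cases hne : P i j = 0
    · exact .inl hne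
    right
    have hres := h.restrict hresp (rfl : π i = π i) (rfl : π j = π j)
    obtain ⟨F, hF⟩ := hPT i j hne
    have hz := (hB (π i)).asymm (hasymm_iso _ _ (hT.symm (hPT i j hne)) hj) _ _ (hres.comp hF)
    have hz' : ∀ l (hl : π l = π j), P i l ≠ 0 → F ⟨i, rfl⟩ = ⟨l, hl⟩ := by
      intro l hl hnl
      by_contra hFl
      refine hnl ?_
      have := hz ⟨i, rfl⟩ (F.symm ⟨l, hl⟩) (fun h => hFl (by rw [h, F.apply_symm_apply]))
      simpa using this
    rw [IsQuantumIso.blockSum, Finset.sum_eq_single_of_mem j (by simp)]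
    intro l hl hlj
    by_contra hnl
    have e1 := hz' l (Finset.mem_filter.1 hl).2 hnl
    rw [hz' j rfl hne, Subtype.mk.injEq] at e1
    exact hlj e1.symm
  have hquot : ∀ i j k l, Commute (IsQuantumIso.blockSum π P i (π j)) (IsQuantumIso.blockSum π P k (π l)) := by
    intro i j k l
    have hqT : ∀ b a, IsQuantumIso.blockSum π P (Function.surjInv hπ b) a ≠ 0 → T b a := fun b a hne =>
      hT.symm ((hB a).rigid _ _ _ _ hne (h.restrict hresp (hr b) (hr a)))
    have := (h.quotient hresp hr hr).commute_of_pairs_meet hT hqT hmeet (π i) (π j) (π k) (π l)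
    rwa [h.blockSum_congr hresp (hr (π i)), h.blockSum_congr hresp (hr (π k))] at this
  by_cases hij : P i j = 0
  · rw [hij]; exact Commute.zero_left _
  by_cases hkl : P k l = 0
  · rw [hkl]; exact Commute.zero_right _
  by_cases hex : ∃ a b, a ≠ b ∧ T a b
  · obtain ⟨a, b, hab, hTab⟩ := hex
    have hall : ∀ c, IsColorAsymmetric (restrictColor R (π · = c)) := by
      intro c
      by_contra hc
      obtain ⟨σ, hσ, hσ1, hσ'⟩ := hswap a b hab hTab
      have hca : c = a ∨ c = b := by
        by_contra! hcon
        obtain ⟨ρ, hρ, hρ1, hρ'⟩ := hasymm_of c hc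
        refine hdis ⟨σ, ρ, hσ, hρ, hσ1, hρ1, fun x => ?_⟩
        by_cases hx : π x = c
        · exact .inl (hσ' x (by rw [hx]; exact hcon.1) (by rw [hx]; exact hcon.2))
        · exact .inr (hρ' x hx)
      rcases hca with rfl | rfl
      · exact hc (hasymm_iso _ _ (hT.symm hTab) (htwo _ _ hab hc))
      · exact hc (hasymm_iso _ _ hTab (htwo _ _ hab.symm hc))
    rw [(hentry i j (hall _)).resolve_left hij, (hentry k l (hall _)).resolve_left hkl]
    exact hquot _ _ _ _
  · push Not at hex
    have hπij : π i = π j := by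
      by_contra hcon
      exact hex _ _ hcon (hPT i j hij)
    have hπkl : π k = π l := by
      by_contra hcon
      exact hex _ _ hcon (hPT k l hkl)
    have hunit : ∀ i j, π i = π j → IsQuantumIso.blockSum π P i (π j) = e := by
      intro i j hπij
      rw [← h.row_sum i, IsQuantumIso.blockSum, Finset.sum_filter]
      refine Finset.sum_congr rfl fun l _ => ?_
      split_ifs with hl
      · rfl
      · by_contra hne
        exact hex _ _ (by rw [hπij]; exact Ne.symm hl) (hPT i l (Ne.symm hne))
    by_cases hj : IsColorAsymmetric (restrictColor R (π · = π j))
    · rw [(hentry i j hj).resolve_left hij, hunit i j hπij]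
      exact (h.unit_mul k l).trans (h.mul_unit k l).symm
    by_cases hl : IsColorAsymmetric (restrictColor R (π · = π l))
    · rw [(hentry k l hl).resolve_left hkl, hunit k l hπkl]
      exact (h.mul_unit i j).trans (h.unit_mul i j).symm
    have hjl : π l = π j := by
      by_contra hcon
      exact hl (htwo _ _ (Ne.symm hcon) hj)
    refine (hB (π j)).comm (fun hd => hdis ?_) _ _ (h.restrict hresp hπij (rfl : π j = π j))
      ⟨i, hπij⟩ ⟨j, rfl⟩ ⟨k, hπkl.trans hjl⟩ ⟨l, hjl⟩
    obtain ⟨f, g, hf, hg, hf1, hg1, hfg⟩ := hd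
    refine ⟨_, _, hf.ofSubtype hR, hg.ofSubtype hR, Equiv.Perm.ofSubtype_ne_one hf1,
      Equiv.Perm.ofSubtype_ne_one hg1, fun x => ?_⟩
    by_cases hx : π x = π j
    · rw [Equiv.Perm.ofSubtype_apply_of_mem f hx, Equiv.Perm.ofSubtype_apply_of_mem g hx]
      exact (hfg ⟨x, hx⟩).imp (congrArg Subtype.val) (congrArg Subtype.val)
    · exact .inl (Equiv.Perm.ofSubtype_apply_of_not_mem f hx)

/-- A pair colouring is tractable if it is determined by tractable blocks, where the blocks are the
classes of the equivalence relation generated by a set of colours. -/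
theorem of_eqvGen [IsAddTorsionFree A] (S : Set K) (φ : K → K → K)
    (hR : ∀ x y, ¬ Relation.EqvGen (fun x y => R x y ∈ S) x y → R x y = φ (R x x) (R y y))
    (hB : ∀ x₀, IsTractable A
      (restrictColor R (Relation.EqvGen (fun x y => R x y ∈ S) · x₀))) :
    IsTractable A R := by
  let s : ∀ {W : Type u} (R' : W → W → K), Setoid W := fun R' =>
    Relation.EqvGen.setoid (fun x y => R' x y ∈ S)
  have hiff : ∀ {W : Type u} (R' : W → W → K) (x y : W), (⟦x⟧ : Quotient (s R')) = ⟦y⟧ ↔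
      Relation.EqvGen (fun x y => R' x y ∈ S) x y := fun R' x y => Quotient.eq
  have hresp : ∀ {W : Type u} [Fintype W] {R' : W → W → K} {e : A} {P : W → V → A},
      IsQuantumIso R R' e P → Respects (fun x y => (⟦x⟧ : Quotient (s R)) = ⟦y⟧)
        (fun x y => (⟦x⟧ : Quotient (s R')) = ⟦y⟧) P := by
    intro W _ R' e P h
    simp only [hiff]
    exact h.respects_eqvGen (h.respects_color S)
  have hR₁ : ∀ x y, (⟦x⟧ : Quotient (s R)) ≠ ⟦y⟧ → R x y = φ (R x x) (R y y) :=
    fun x y hxy => hR x y fun h => hxy ((hiff _ _ _).2 h)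
  have hB₁ : ∀ a : Quotient (s R), IsTractable A
      (restrictColor R (fun x => (⟦x⟧ : Quotient (s R)) = a)) := by
    intro a
    induction a using Quotient.inductionOn with | _ a => ?_
    exact (hB a).restrict_congr fun x => (hiff R x a).symm
  refine ⟨fun W _ R' e P he h => ?_, fun hasymm e P h => ?_, fun hdis e P h => ?_⟩
  · exact exists_colorIso_of_blocks hR₁ Quotient.mk_surjective (by convert hB₁)
      Quotient.mk_surjective he h (hresp h)
  · exact asymm_of_blocks hR₁ (by convert hB₁) hasymm h (hresp h)
  · exact comm_of_blocks hR₁ Quotient.mk_surjective (by convert hB₁) hdis h (hresp h)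

/-- Tractability passes from a canonically defined refinement to the coarser colouring. -/
theorem of_refinement {L : Type*} {R₂ : V → V → L} (h₂ : IsTractable A R₂)
    (hrigid : ∀ (W : Type u) [Fintype W] (R' : W → W → K) (e : A) (P : W → V → A), e ≠ 0 →
      IsQuantumIso R R' e P → ∃ R₂' : W → W → L, IsQuantumIso R₂ R₂' e P ∧
        ∀ f, IsColorIso R₂ R₂' f → IsColorIso R R' f)
    (hself : ∀ (e : A) (P : V → V → A), IsQuantumIso R R e P → IsQuantumIso R₂ R₂ e P)
    (hauto : ∀ f, IsColorIso R₂ R₂ f → IsColorIso R R f) : IsTractable A R where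
  rigid W _ R' e P he h := by
    obtain ⟨R₂', h', hiso⟩ := hrigid W R' e P he h
    obtain ⟨f, hf⟩ := h₂.rigid W R₂' e P he h'
    exact ⟨f, hiso f hf⟩
  asymm ha e P h := h₂.asymm (fun f hf => ha f (hauto f hf)) e P (hself e P h)
  comm hd e P h := h₂.comm (fun ⟨f, g, hf, hg, h⟩ => hd ⟨f, g, hauto f hf, hauto g hg, h⟩) e P
    (hself e P h)

theorem of_subsingleton [Nonempty V] [Subsingleton V] (R : V → V → K) : IsTractable A R where
  rigid W _ R' e P he h := by
    obtain ⟨x⟩ := ‹Nonempty V›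
    have hP : ∀ i, P i x = e := fun i => by
      rw [← h.row_sum i, Finset.sum_eq_single x (fun y _ hy => absurd (Subsingleton.elim y x) hy)
        (by simp)]
    have hW : Subsingleton W := ⟨fun i k => by
      by_contra hik
      refine he ?_
      rw [← hP i, ← h.mul_unit i x, ← hP k, h.col_orth _ _ _ hik]⟩
    have hW' : Nonempty W := by
      obtain ⟨i, -⟩ := h.symm.exists_ne_zero he x
      exact ⟨i⟩
    obtain ⟨w⟩ := hW'
    refine ⟨⟨fun _ => w, fun _ => x, fun _ => Subsingleton.elim _ _,
      fun _ => Subsingleton.elim _ _⟩, fun y z => ?_⟩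
    rw [Subsingleton.elim y z]
    exact (h.color_diag (by rw [Subsingleton.elim z x]; exact (hP w).symm ▸ he))
  asymm _ _ _ _ i j hij := absurd (Subsingleton.elim i j) hij
  comm _ _ _ _ i j k l := by
    rw [Subsingleton.elim i k, Subsingleton.elim j l]

end IsTractable

end Tractable

/-! ### Trees -/

section Trees

open Classical

theorem SimpleGraph.reachable_iff_eqvGen {V : Type*} (G : SimpleGraph V) (x y : V) :
    G.Reachable x y ↔ Relation.EqvGen G.Adj x y := by
  constructor
  · rintro ⟨p⟩
    induction p with
    | nil => exact .refl _
    | cons h _ ih => exact (Relation.EqvGen.rel _ _ h).trans _ _ _ ih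
  · intro h
    induction h with
    | rel x y h => exact h.reachable
    | refl x => exact .refl _
    | symm x y _ ih => exact ih.symm
    | trans x y z _ _ ih1 ih2 => exact ih1.trans ih2

/-- Every vertex has at most one neighbour whose level is not larger than its own. -/
def SimpleGraph.IsLevelForest {V : Type*} (G : SimpleGraph V) (c : V → ℕ) : Prop :=
  ∀ v u u', G.Adj v u → G.Adj v u' → c u ≤ c v → c u' ≤ c v → u = u'

/-- The pair colouring of a graph whose vertices carry levels. -/
def SimpleGraph.levelColor {V : Type*} (G : SimpleGraph V) (c : V → ℕ) (x y : V) :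
    ℕ × ℕ × Prop :=
  (c x, c y, G.Adj x y)

theorem SimpleGraph.IsLevelForest.adj_of_reachable {V : Type*} {G : SimpleGraph V} {c : V → ℕ}
    (hc : G.IsLevelForest c) {x y : V} (hxy : x ≠ y) (hr : G.Reachable x y)
    (hmin : ∀ u v, G.Adj u v → c x + c y ≤ c u + c v) : G.Adj x y := by
  obtain ⟨p, hp⟩ := hr.exists_isPath
  have hn0 : p.length ≠ 0 := fun h => hxy (p.eq_of_length_eq_zero h)
  by_cases hn1 : p.length = 1
  · exact p.adj_of_length_eq_one hn1
  exfalso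
  have hadj : ∀ i, i < p.length → G.Adj (p.getVert i) (p.getVert (i + 1)) :=
    fun i hi => p.adj_getVert_succ hi
  obtain ⟨i, hi, hmax⟩ := Finset.exists_max_image (Finset.Ico 1 p.length)
    (fun i => c (p.getVert i)) ⟨1, by simp; omega⟩
  rw [Finset.mem_Ico] at hi
  obtain ⟨i, rfl⟩ : ∃ k, i = k + 1 := ⟨i - 1, by omega⟩
  have hy : c y ≤ c (p.getVert (i + 1)) := by
    have h1 := hmin _ _ (hadj 0 (by omega))
    have h2 := hmax 1 (by simp; omega)
    rw [p.getVert_zero, zero_add] at h1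
    omega
  have hx : c x ≤ c (p.getVert (i + 1)) := by
    have h1 := hmin _ _ (hadj (p.length - 1) (by omega))
    have h2 := hmax (p.length - 1) (by simp; omega)
    rw [Nat.sub_add_cancel (by omega), p.getVert_length] at h1
    omega
  have hprev : c (p.getVert i) ≤ c (p.getVert (i + 1)) := by
    rcases Nat.eq_zero_or_pos i with h0 | h0
    · subst h0
      simpa using hx
    · exact hmax i (by simp; omega)
  have hnext : c (p.getVert (i + 2)) ≤ c (p.getVert (i + 1)) := by
    rcases Nat.lt_or_ge (i + 2) p.length with h0 | h0
    · exact hmax (i + 2) (by simp; omega)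
    · rw [show i + 2 = p.length by omega, p.getVert_length]
      exact hy
  have := hc _ _ _ (hadj i (by omega)).symm (hadj (i + 1) (by omega)) hprev hnext
  have := hp.getVert_injOn (by simp; omega) (by simp; omega) this
  omega

theorem SimpleGraph.IsLevelForest.mono {V : Type*} {G H : SimpleGraph V} {c : V → ℕ}
    (hc : G.IsLevelForest c) (hHG : H ≤ G) : H.IsLevelForest c :=
  fun v u u' h h' => hc v u u' (hHG h) (hHG h')

/-- Some set `M` of level sums cuts a level forest into several pieces such that vertices of
different pieces are adjacent exactly if the sum of their levels lies in `M`. -/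
theorem SimpleGraph.IsLevelForest.exists_cut {V : Type*} [Finite V] [Nontrivial V]
    {G : SimpleGraph V} {c : V → ℕ} (hc : G.IsLevelForest c) :
    ∃ (M : Set ℕ) (Γ : SimpleGraph V), (∀ x y, Γ.Adj x y ↔ G.Adj x y ∧ c x + c y ∉ M) ∧
      ¬ Γ.Preconnected ∧ ∀ x y, ¬ Γ.Reachable x y → c x + c y ∈ M → G.Adj x y := by
  by_cases hG : G.Preconnected
  swap
  · exact ⟨∅, G, by simp, hG, by simp⟩
  let E : Set ℕ := {n | ∃ x y, G.Adj x y ∧ c x + c y = n}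
  have hE : E.Nonempty := by
    obtain ⟨x, y, hxy⟩ := exists_pair_ne V
    obtain ⟨p⟩ := hG x y
    cases p with
    | nil => exact absurd rfl hxy
    | cons h _ => exact ⟨_, _, _, h, rfl⟩
  have hmin : ∀ u v, G.Adj u v → sInf E ≤ c u + c v := fun u v h => Nat.sInf_le ⟨u, v, h, rfl⟩
  let Γ : SimpleGraph V :=
    { Adj := fun x y => G.Adj x y ∧ c x + c y ≠ sInf E
      symm := ⟨fun x y h => ⟨h.1.symm, by rw [add_comm]; exact h.2⟩⟩
      loopless := ⟨fun x h => G.loopless.irrefl x h.1⟩ }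
  have hΓ : Γ ≤ G := fun x y h => h.1
  refine ⟨{sInf E}, Γ, fun x y => Iff.rfl, fun hcon => ?_, fun x y hxy hM => ?_⟩
  · obtain ⟨x, y, hxy, hm⟩ := Nat.sInf_mem hE
    exact ((hc.mono hΓ).adj_of_reachable hxy.ne (hcon x y)
      fun u v h => hm ▸ hmin u v (hΓ h)).2 hm
  · have hne : x ≠ y := by
      rintro rfl
      exact hxy (.refl _)
    have hM' : c x + c y = sInf E := hM
    exact hc.adj_of_reachable hne (hG x y) fun u v h => hM' ▸ hmin u v h

theorem SimpleGraph.IsLevelForest.isTractable {A : Type v} [Ring A] [IsAddTorsionFree A] (n : ℕ) :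
    ∀ (V : Type u) [Fintype V] [Nonempty V] (G : SimpleGraph V) (c : V → ℕ),
      Fintype.card V = n → G.IsLevelForest c → IsTractable A (G.levelColor c) := by
  induction n using Nat.strong_induction_on with
  | _ n ih =>
    intro V _ _ G c hn hc
    rcases subsingleton_or_nontrivial V with hV | hV
    · exact .of_subsingleton _
    obtain ⟨M, Γ, hΓ, hdis, hcut⟩ := hc.exists_cut
    have hS : (fun x y => G.levelColor c x y ∈ {κ : ℕ × ℕ × Prop | κ.2.2 ∧ κ.1 + κ.2.1 ∉ M}) =
        Γ.Adj := by
      ext x y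
      exact (hΓ x y).symm
    refine .of_eqvGen {κ : ℕ × ℕ × Prop | κ.2.2 ∧ κ.1 + κ.2.1 ∉ M}
      (fun κ κ' => (κ.1, κ'.1, κ.1 + κ'.1 ∈ M)) (fun x y hxy => ?_) fun x₀ => ?_
    · rw [hS, ← Γ.reachable_iff_eqvGen] at hxy
      have : G.Adj x y = (c x + c y ∈ M) := by
        refine propext ⟨fun h => ?_, hcut x y hxy⟩
        by_contra hM
        exact hxy ((hΓ x y).2 ⟨h, hM⟩).reachable
      simp only [SimpleGraph.levelColor, this]
    · have : Nonempty {x // Relation.EqvGen (fun x y => G.levelColor c x y ∈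
          {κ : ℕ × ℕ × Prop | κ.2.2 ∧ κ.1 + κ.2.1 ∉ M}) x x₀} := ⟨⟨x₀, .refl _⟩⟩
      refine ih _ ?_ _ (G.comap Subtype.val) (c ∘ Subtype.val) rfl fun v w w' h h' hw hw' =>
        Subtype.ext (hc v.1 w.1 w'.1 h h' hw hw')
      rw [← hn]
      obtain ⟨x, hx⟩ : ∃ x, ¬ Γ.Reachable x x₀ := by
        by_contra! hcon
        exact hdis fun x y => (hcon x).trans (hcon y).symm
      refine Fintype.card_subtype_lt (x := x) ?_
      rwa [hS, ← Γ.reachable_iff_eqvGen]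

/-- The largest distance from `v`. -/
noncomputable def SimpleGraph.maxDist {V : Type*} [Fintype V] (G : SimpleGraph V) (v : V) : ℕ :=
  Finset.univ.sup (G.dist v)

theorem SimpleGraph.IsTree.dist_lt_of_adj {V : Type*} {G : SimpleGraph V} (hG : G.IsTree)
    {v u u' : V} (hu : G.Adj v u) (hu' : G.Adj v u') (hne : u ≠ u') (w : V) :
    G.dist v w < G.dist u w ∨ G.dist v w < G.dist u' w := by
  by_contra! hcon
  have key : ∀ u, G.Adj v u → G.dist u w ≤ G.dist v w →
      ∃ p : G.Walk v w, p.IsPath ∧ p.snd = u := by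
    intro u hu hle
    obtain ⟨p, hp, hlen⟩ := hG.1.exists_path_of_dist u w
    refine ⟨.cons hu p, ?_, by simp⟩
    rw [SimpleGraph.Walk.cons_isPath_iff]
    refine ⟨hp, fun hv => ?_⟩
    have h1 := congrArg SimpleGraph.Walk.length (p.take_spec hv)
    rw [SimpleGraph.Walk.length_append] at h1
    have h2 := SimpleGraph.dist_le (p.dropUntil v hv)
    have h3 : (p.takeUntil v hv).length ≠ 0 := fun h0 =>
      hu.ne (SimpleGraph.Walk.eq_of_length_eq_zero h0).symm
    omega
  obtain ⟨p, hp, hpu⟩ := key u hu hcon.1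
  obtain ⟨p', hp', hpu'⟩ := key u' hu' hcon.2
  have := congrArg Subtype.val ((hG.2.subsingleton_path _ _).elim ⟨p, hp⟩ ⟨p', hp'⟩)
  simp only at this
  exact hne (by rw [← hpu, ← hpu', this])

theorem SimpleGraph.IsTree.isLevelForest_maxDist {V : Type*} [Fintype V] {G : SimpleGraph V}
    (hG : G.IsTree) : G.IsLevelForest G.maxDist := by
  intro v u u' hu hu' hle hle'
  by_contra hne
  obtain ⟨w, -, hw⟩ := Finset.exists_mem_eq_sup Finset.univ ⟨v, Finset.mem_univ v⟩ (G.dist v)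
  have h1 : G.dist u w ≤ G.maxDist u := Finset.le_sup (Finset.mem_univ w)
  have h2 : G.dist u' w ≤ G.maxDist u' := Finset.le_sup (Finset.mem_univ w)
  have h3 : G.maxDist v = G.dist v w := hw
  rcases hG.dist_lt_of_adj hu hu' hne w with h | h <;> omega

section

variable {V W : Type*} [Fintype V] [Fintype W] {A : Type v} [Ring A] {e : A} {P : W → V → A}

theorem IsQuantumIso.exists_graph {G : SimpleGraph V} {R' : W → W → Prop} (he : e ≠ 0)
    (h : IsQuantumIso G.Adj R' e P) : ∃ H : SimpleGraph W, H.Adj = R' := by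
  refine ⟨⟨R', ⟨fun i k hik => ?_⟩, ⟨fun i hi => ?_⟩⟩, rfl⟩
  · obtain ⟨j, hj⟩ := h.exists_ne_zero he i
    obtain ⟨l, hl⟩ := h.exists_mul_ne_zero hj k
    rw [h.color_eq _ _ _ _ hl] at hik
    rw [h.color_eq _ _ _ _ (h.mul_ne_zero_comm hl)]
    exact hik.symm
  · obtain ⟨j, hj⟩ := h.exists_ne_zero he i
    rw [h.color_diag hj] at hi
    exact G.loopless.irrefl j hi

theorem IsQuantumIso.respects_adj {G : SimpleGraph V} {H : SimpleGraph W}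
    (h : IsQuantumIso G.Adj H.Adj e P) : Respects G.Adj H.Adj P :=
  fun i j k l hne => by rw [h.color_eq i j k l hne]

theorem IsQuantumIso.maxDist_le {G : SimpleGraph V} {H : SimpleGraph W}
    (h : IsQuantumIso G.Adj H.Adj e P) {i j} (hne : P i j ≠ 0) : H.maxDist i ≤ G.maxDist j :=
  Finset.sup_le fun k _ => by
    obtain ⟨l, hl⟩ := h.exists_mul_ne_zero hne k
    rw [h.respects_dist h.respects_adj hl]
    exact Finset.le_sup (Finset.mem_univ l)

theorem IsQuantumIso.levelColor_maxDist {G : SimpleGraph V} {H : SimpleGraph W}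
    (h : IsQuantumIso G.Adj H.Adj e P) :
    IsQuantumIso (G.levelColor G.maxDist) (H.levelColor H.maxDist) e P where
  mul_self := h.mul_self
  row_sum := h.row_sum
  col_sum := h.col_sum
  row_orth := h.row_orth
  col_orth := h.col_orth
  zero_comm := h.zero_comm
  color_eq i j k l hne := by
    have hd : ∀ i j, P i j ≠ 0 → H.maxDist i = G.maxDist j := fun i j hn =>
      (h.maxDist_le hn).antisymm (h.symm.maxDist_le hn)
    rw [SimpleGraph.levelColor, SimpleGraph.levelColor, hd i j (left_ne_zero_of_mul hne),
      hd k l (right_ne_zero_of_mul hne), h.color_eq _ _ _ _ hne]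

end

theorem SimpleGraph.IsTree.isTractable {V : Type u} [Fintype V] {A : Type v} [Ring A]
    [IsAddTorsionFree A] {G : SimpleGraph V} (hG : G.IsTree) : IsTractable A G.Adj := by
  have := hG.1.nonempty
  refine (IsLevelForest.isTractable _ V G G.maxDist rfl hG.isLevelForest_maxDist).of_refinement
    (fun W _ R' e P he h => ?_) (fun e P h => h.levelColor_maxDist)
    fun f hf x y => congrArg (fun κ => κ.2.2) (hf x y)
  obtain ⟨H, rfl⟩ := h.exists_graph he
  exact ⟨_, h.levelColor_maxDist, fun f hf x y => congrArg (fun κ => κ.2.2) (hf x y)⟩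

end Trees

/-! ### The structure of tree-cographs -/

namespace SimpleGraph

/-- An isomorphism between induced subgraphs on corresponding sets. -/
def Iso.inducedIso {V W : Type*} {G : SimpleGraph V} {H : SimpleGraph W} (e : G ≃g H) {s : Set V}
    {t : Set W} (h : ∀ x, x ∈ s ↔ e x ∈ t) : G.induce s ≃g H.induce t where
  toEquiv := e.toEquiv.subtypeEquiv h
  map_rel_iff' := e.map_rel_iff

/-- Complementation does not change the isomorphisms. -/
def Iso.complIso {V W : Type*} {G : SimpleGraph V} {H : SimpleGraph W} (e : G ≃g H) :
    Gᶜ ≃g Hᶜ where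
  toEquiv := e.toEquiv
  map_rel_iff' := by
    intro x y
    simp only [compl_adj]
    exact and_congr e.injective.ne_iff (not_congr e.map_rel_iff)

theorem induce_compl {V : Type*} (G : SimpleGraph V) (s : Set V) :
    Gᶜ.induce s = (G.induce s)ᶜ := by
  ext x y
  simp [compl_adj, Subtype.ext_iff]

theorem reachable_sum_inl {V W : Type*} (G : SimpleGraph V) (H : SimpleGraph W) (a : V ⊕ W)
    (v : V) : (G ⊕g H).Reachable a (.inl v) ↔ ∃ w, a = .inl w ∧ G.Reachable w v := by
  constructor
  · intro h
    rw [reachable_iff_reflTransGen] at h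
    induction h using Relation.ReflTransGen.head_induction_on with
    | refl => exact ⟨v, rfl, .refl _⟩
    | head h _ ih =>
      obtain ⟨w, rfl, hw⟩ := ih
      rename_i a _
      rcases a with a | a
      · exact ⟨a, rfl, (sum_adj_inl.1 h).reachable.trans hw⟩
      · exact absurd h.symm (not_adj_sum_inl_inr _ _)
  · rintro ⟨w, rfl, hw⟩
    exact hw.map Embedding.sumInl.toHom

namespace IsTreeCograph

theorem nonempty {V : Type u} {G : SimpleGraph V} (h : G.IsTreeCograph) : Nonempty V := by
  induction h with
  | tree G hG => exact hG.1.nonempty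
  | sum G H _ _ ih _ => exact ih.map Sum.inl
  | compl G _ ih => exact ih
  | iso G H e _ ih => exact ih.map e

theorem bot (V : Type u) [Finite V] [Nonempty V] : (⊥ : SimpleGraph V).IsTreeCograph := by
  suffices h : ∀ (V : Type u) [Finite V], Nonempty V → (⊥ : SimpleGraph V).IsTreeCograph from
    h V ‹_›
  intro V _
  induction V using Finite.induction_empty_option with
  | of_equiv e ih =>
    intro h
    exact .iso _ _ ⟨e, by simp⟩ (ih (h.map e.symm))
  | h_empty => exact fun h => h.elim PEmpty.elim
  | @h_option V _ ih =>
    intro _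
    rcases isEmpty_or_nonempty V with hV | hV
    · exact .tree _ IsTree.of_subsingleton
    · refine .iso _ _ ⟨(Equiv.optionEquivSumPUnit V).symm, ?_⟩
        (.sum _ _ (ih hV) (.tree (⊥ : SimpleGraph PUnit) IsTree.of_subsingleton))
      rintro (x | x) (y | y) <;> simp

theorem isTree_or_not_preconnected {V : Type u} {G : SimpleGraph V} (h : G.IsTreeCograph) :
    G.IsTree ∨ Gᶜ.IsTree ∨ ¬ G.Preconnected ∨ ¬ Gᶜ.Preconnected := by
  induction h with
  | tree G hG => exact .inl hG
  | sum G H hG hH _ _ =>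
    have := hG.nonempty
    have := hH.nonempty
    exact .inr (.inr (.inl not_preconnected_sum))
  | compl G _ ih =>
    rw [compl_compl]
    tauto
  | iso G H e _ ih =>
    rwa [← e.isTree_iff, ← e.complIso.isTree_iff, ← e.preconnected_iff,
      ← e.complIso.preconnected_iff]

theorem induce_of_preconnected {V : Type u} {G Γ : SimpleGraph V} (h : G.IsTreeCograph)
    (hΓ : Γ.Preconnected) (x : V) : (G.induce {y | Γ.Reachable y x}).IsTreeCograph := by
  rw [show {y | Γ.Reachable y x} = Set.univ from Set.eq_univ_of_forall fun y => hΓ y x]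
  exact .iso _ _ G.induceUnivIso.symm h

theorem induce_component_iso {V W : Type u} {G Γ : SimpleGraph V} {H Δ : SimpleGraph W}
    (e : G ≃g H) (e' : Γ ≃g Δ) (he : ∀ x, e x = e' x)
    (h : ∀ x, (G.induce {y | Γ.Reachable y x}).IsTreeCograph) (x : W) :
    (H.induce {y | Δ.Reachable y x}).IsTreeCograph := by
  refine .iso _ _ (e.inducedIso fun y => ?_) (h (e'.symm x))
  rw [Set.mem_ofPred_eq, Set.mem_ofPred_eq, he, ← Iso.reachable_iff (φ := e'), e'.apply_symm_apply]

theorem induce_component {V : Type u} {G : SimpleGraph V} (h : G.IsTreeCograph) :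
    (∀ x, (G.induce {y | G.Reachable y x}).IsTreeCograph) ∧
      ∀ x, (G.induce {y | Gᶜ.Reachable y x}).IsTreeCograph := by
  induction h with
  | tree G hG =>
    refine ⟨(tree G hG).induce_of_preconnected hG.1.preconnected, fun x => ?_⟩
    by_cases hc : Gᶜ.Preconnected
    · exact (tree G hG).induce_of_preconnected hc x
    obtain ⟨r, hr⟩ : ∃ r, ¬ Gᶜ.Reachable r x := by
      by_contra! hcon
      exact hc fun a b => (hcon a).trans (hcon b).symm
    have hadj : ∀ y, Gᶜ.Reachable y x → G.Adj r y := by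
      intro y hy
      by_contra hry
      by_cases hne : r = y
      · exact hr (hne ▸ hy)
      · have : Gᶜ.Adj r y := ⟨hne, hry⟩
        exact hr (this.reachable.trans hy)
    have hbot : G.induce {y | Gᶜ.Reachable y x} = ⊥ := by
      ext ⟨y, hy⟩ ⟨z, hz⟩
      simp only [comap_adj, Function.Embedding.subtype_apply, bot_adj, iff_false]
      intro hyz
      have h3 := hG.dist_lt_of_adj (hadj y hy) (hadj z hz) hyz.ne y
      rw [dist_eq_one_iff_adj.2 (hadj y hy), dist_eq_one_iff_adj.2 hyz.symm, dist_self] at h3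
      omega
    have : Nonempty {y | Gᶜ.Reachable y x} := ⟨⟨x, .refl _⟩⟩
    rw [hbot]
    exact .bot _
  | @sum V W G H hG hH ihG ihH =>
    have := hG.nonempty
    have := hH.nonempty
    have key : ∀ {V W : Type u} (G : SimpleGraph V) (H : SimpleGraph W),
        (∀ x, (G.induce {y | G.Reachable y x}).IsTreeCograph) →
        ∀ v, ((G ⊕g H).induce {y | (G ⊕g H).Reachable y (.inl v)}).IsTreeCograph := by
      intro V W G H hG v
      have hset : {y | (G ⊕g H).Reachable y (.inl v)} = Sum.inl '' {y | G.Reachable y v} := by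
        ext a
        rw [Set.mem_ofPred_eq, reachable_sum_inl]
        constructor
        · rintro ⟨w, rfl, hw⟩
          exact ⟨w, hw, rfl⟩
        · rintro ⟨w, hw, rfl⟩
          exact ⟨w, rfl, hw⟩
      rw [hset]
      exact .iso _ _ ⟨Equiv.Set.image _ _ Sum.inl_injective, by simp⟩ (hG v)
    refine ⟨fun x => ?_, (sum G H hG hH).induce_of_preconnected
      ((G ⊕g H).connected_or_connected_compl.resolve_left not_connected_sum).preconnected⟩
    rcases x with v | w
    · exact key G H ihG.1 v
    · refine .iso _ _ ((Iso.sumComm (G := H) (H := G)).inducedIso fun y => ?_) (key H G ihH.1 w)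
      rw [Set.mem_ofPred_eq, Set.mem_ofPred_eq, ← Iso.reachable_iff (φ := Iso.sumComm (G := H) (H := G))]
      rfl
  | compl G _ ih =>
    simp only [induce_compl]
    rw [compl_compl]
    exact ⟨fun x => (ih.2 x).compl, fun x => (ih.1 x).compl⟩
  | iso G H e _ ih =>
    exact ⟨induce_component_iso e e (fun _ => rfl) ih.1,
      induce_component_iso e e.complIso (fun _ => rfl) ih.2⟩

end IsTreeCograph

end SimpleGraph

section

open Classical

theorem IsQuantumIso.of_iff {K L V W A : Type*} [Fintype V] [Fintype W] [Ring A] {R : V → V → K}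
    {R' : W → W → K} {e : A} {P : W → V → A} (h : IsQuantumIso R R' e P) {R₂ : V → V → L}
    {R₂' : W → W → L} (hcol : ∀ i j k l, P i j * P k l ≠ 0 → R₂' i k = R₂ j l) :
    IsQuantumIso R₂ R₂' e P :=
  { h with color_eq := hcol }

theorem IsTractable.of_compl {V : Type u} [Fintype V] {A : Type v} [Ring A] {G : SimpleGraph V}
    (h : IsTractable A Gᶜ.Adj) : IsTractable A G.Adj := by
  have key : ∀ {W : Type u} [Fintype W] {H : SimpleGraph W} {e : A} {P : W → V → A},
      IsQuantumIso G.Adj H.Adj e P → IsQuantumIso Gᶜ.Adj Hᶜ.Adj e P := by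
    intro W _ H e P hP
    refine hP.of_iff fun i j k l hne => ?_
    have h1 := hP.color_eq _ _ _ _ hne
    have h2 := hP.respects_eq _ _ _ _ hne
    simp only [SimpleGraph.compl_adj, h1, h2, ne_eq]
  have hiso : ∀ {W : Type u} {H : SimpleGraph W} {f : V ≃ W}, IsColorIso Gᶜ.Adj Hᶜ.Adj f →
      IsColorIso G.Adj H.Adj f := by
    intro W H f hf x y
    have h1 := hf x y
    simp only [SimpleGraph.compl_adj, ne_eq, f.apply_eq_iff_eq, eq_iff_iff] at h1
    by_cases hxy : x = y
    · subst hxy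
      simp
    · exact propext (by tauto)
  refine h.of_refinement (fun W _ R' e P he hP => ?_) (fun e P hP => key hP) fun f hf => hiso hf
  obtain ⟨H, rfl⟩ := hP.exists_graph he
  exact ⟨_, key hP, fun f hf => hiso hf⟩

theorem SimpleGraph.IsTreeCograph.isTractable_of_card {A : Type v} [Ring A] [IsAddTorsionFree A]
    (n : ℕ) : ∀ (V : Type u) [Fintype V] (G : SimpleGraph V), Fintype.card V = n →
      G.IsTreeCograph → IsTractable A G.Adj := by
  induction n using Nat.strong_induction_on with
  | _ n ih =>
    have hstep : ∀ (V : Type u) [Fintype V] (G : SimpleGraph V), Fintype.card V = n →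
        G.IsTreeCograph → ¬ G.Preconnected → IsTractable A G.Adj := by
      intro V _ G hn hG hdis
      have hS : (fun x y => G.Adj x y ∈ {κ : Prop | κ}) = G.Adj := rfl
      refine .of_eqvGen {κ : Prop | κ} (fun _ _ => False) (fun x y hxy => ?_) fun x₀ => ?_
      · rw [hS, ← G.reachable_iff_eqvGen] at hxy
        exact propext ⟨fun h => hxy h.reachable, False.elim⟩
      · refine IsTractable.restrict_congr (p := fun y => G.Reachable y x₀)
          (ih _ ?_ _ (G.induce {y | G.Reachable y x₀}) rfl (hG.induce_component.1 x₀))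
          fun x => G.reachable_iff_eqvGen x x₀
        rw [← hn]
        obtain ⟨x, hx⟩ : ∃ x, ¬ G.Reachable x x₀ := by
          by_contra! hcon
          exact hdis fun x y => (hcon x).trans (hcon y).symm
        exact Fintype.card_subtype_lt hx
    intro V _ G hn hG
    rcases hG.isTree_or_not_preconnected with h | h | h | h
    · exact h.isTractable
    · exact .of_compl h.isTractable
    · exact hstep V G hn hG h
    · exact .of_compl (hstep V Gᶜ hn hG.compl h)

theorem SimpleGraph.IsTreeCograph.isTractable {V : Type u} [Fintype V] {G : SimpleGraph V}
    (hG : G.IsTreeCograph) (A : Type v) [Ring A] [IsAddTorsionFree A] : IsTractable A G.Adj :=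
  hG.isTractable_of_card _ V G rfl

end

/-! ### Universal property of `𝒪(Qu(G))` -/

theorem FreeStarAlgebra.star_algebraMap {X : Type u} (c : ℂ) :
    star (algebraMap ℂ (FreeStarAlgebra X) c) = algebraMap ℂ (FreeStarAlgebra X) (star c) :=
  congrArg MulOpposite.unop (adjointHom_algebraMap c)

/-- The variables and their formal adjoints. -/
noncomputable def FreeStarAlgebra.ι {X : Type u} (x : X ⊕ X) : FreeStarAlgebra X :=
  FreeAlgebra.ι ℂ x

theorem FreeStarAlgebra.star_ι {X : Type u} (x : X ⊕ X) :
    star (FreeStarAlgebra.ι x) = FreeStarAlgebra.ι x.swap :=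
  congrArg MulOpposite.unop (adjointHom_ι x)

/-- The evaluation of noncommutative `*`-polynomials. -/
noncomputable def FreeStarAlgebra.lift {X : Type u} {B : Type v} [Ring B] [StarRing B]
    [Algebra ℂ B] (f : X → B) : FreeStarAlgebra X →ₐ[ℂ] B :=
  FreeAlgebra.lift ℂ (Sum.elim f fun x => star (f x))

section Lift

variable {X : Type u} {B : Type v} [Ring B] [StarRing B] [Algebra ℂ B]

theorem FreeStarAlgebra.lift_ι (f : X → B) (x : X ⊕ X) :
    FreeStarAlgebra.lift f (FreeStarAlgebra.ι x) = Sum.elim f (fun x => star (f x)) x :=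
  FreeAlgebra.lift_ι_apply _ _

theorem FreeStarAlgebra.lift_var (f : X → B) (x : X) :
    FreeStarAlgebra.lift f (FreeStarAlgebra.var x) = f x :=
  FreeStarAlgebra.lift_ι f (.inl x)

theorem FreeStarAlgebra.induction {p : FreeStarAlgebra X → Prop}
    (algebraMap : ∀ c, p (algebraMap ℂ _ c)) (ι : ∀ x, p (FreeStarAlgebra.ι x))
    (mul : ∀ a b, p a → p b → p (a * b)) (add : ∀ a b, p a → p b → p (a + b))
    (a : FreeStarAlgebra X) : p a :=
  FreeAlgebra.induction ℂ (X ⊕ X) algebraMap ι mul add a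

theorem FreeStarAlgebra.lift_star [StarModule ℂ B] (f : X → B) (a : FreeStarAlgebra X) :
    FreeStarAlgebra.lift f (star a) = star (FreeStarAlgebra.lift f a) := by
  induction a using FreeStarAlgebra.induction with
  | algebraMap c =>
    rw [FreeStarAlgebra.star_algebraMap, AlgHom.commutes, AlgHom.commutes, algebraMap_star_comm]
  | ι x =>
    rw [FreeStarAlgebra.star_ι, FreeStarAlgebra.lift_ι, FreeStarAlgebra.lift_ι]
    rcases x with x | x <;> simp
  | mul a b ha hb => rw [star_mul, map_mul, map_mul, star_mul, ha, hb]
  | add a b ha hb => rw [star_add, map_add, map_add, star_add, ha, hb]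

end Lift

section

open Classical

namespace QuantumAut

variable {V : Type u} [Fintype V] (G : SimpleGraph V)

/-- The generators of `𝒪(Qu(G))`. -/
noncomputable def gen (i j : V) : QuantumAut G := mk G (varMatrix V i j)

variable {G}

theorem mk_eq_of_rel {a b : FreeStarAlgebra (V × V)} (h : Rel G a b) : mk G a = mk G b :=
  RingQuot.mkAlgHom_rel ℂ h

theorem mk_surjective : Function.Surjective (mk G) := RingQuot.mkAlgHom_surjective ℂ (Rel G)

theorem isMagicUnitary_gen : IsMagicUnitary (Matrix.of (gen G)) where
  star_eq i j := (star_mk _ _).trans (mk_eq_of_rel (.star_eq i j))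
  mul_self i j := ((mk G).map_mul _ _).symm.trans (mk_eq_of_rel (.mul_self i j))
  row_sum i := (map_sum (mk G) _ _).symm.trans ((mk_eq_of_rel (.row_sum i)).trans (mk G).map_one)
  col_sum j := (map_sum (mk G) _ _).symm.trans ((mk_eq_of_rel (.col_sum j)).trans (mk G).map_one)
  row_orthogonal i j k h := ((mk G).map_mul _ _).symm.trans
    ((mk_eq_of_rel (.row_orthogonal i j k h)).trans (mk G).map_zero)
  col_orthogonal i k j h := ((mk G).map_mul _ _).symm.trans
    ((mk_eq_of_rel (.col_orthogonal i k j h)).trans (mk G).map_zero)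

theorem gen_mul_adjMatrix : Matrix.of (gen G) * G.adjMatrix (QuantumAut G) =
    G.adjMatrix (QuantumAut G) * Matrix.of (gen G) := by
  ext i j
  have h := mk_eq_of_rel (Rel.adj_comm (G := G) i j)
  rw [SimpleGraph.adjMatrix_mul_apply, SimpleGraph.mul_adjMatrix_apply, map_sum, map_sum] at h
  rw [SimpleGraph.adjMatrix_mul_apply, SimpleGraph.mul_adjMatrix_apply]
  exact h.symm

theorem induction {p : QuantumAut G → Prop} (algebraMap : ∀ c, p (algebraMap ℂ _ c))
    (gen : ∀ i j, p (gen G i j)) (mul : ∀ a b, p a → p b → p (a * b))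
    (add : ∀ a b, p a → p b → p (a + b)) (a : QuantumAut G) : p a := by
  obtain ⟨a, rfl⟩ := mk_surjective a
  induction a using FreeStarAlgebra.induction with
  | algebraMap c => rw [AlgHom.commutes]; exact algebraMap c
  | ι x =>
    rcases x with ⟨i, j⟩ | ⟨i, j⟩
    · exact gen i j
    · have h := isMagicUnitary_gen.star_eq (P := Matrix.of (QuantumAut.gen G)) i j
      have h' : mk G (FreeStarAlgebra.ι (Sum.inr (i, j))) = QuantumAut.gen G i j := by
        rw [← show star (QuantumAut.gen G i j) = QuantumAut.gen G i j from h]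
        exact ((star_mk G _).trans (congrArg (mk G) (FreeStarAlgebra.star_ι (Sum.inl (i, j))))).symm
      exact h' ▸ gen i j
  | mul a b ha hb => rw [map_mul]; exact mul _ _ ha hb
  | add a b ha hb => rw [map_add]; exact add _ _ ha hb

variable {B : Type v} [Ring B] [StarRing B] [Algebra ℂ B] [StarModule ℂ B]

theorem exists_lift {P : Matrix V V B} (hP : IsMagicUnitary P)
    (hG : P * G.adjMatrix B = G.adjMatrix B * P) :
    ∃ χ : QuantumAut G →ₐ[ℂ] B, ∀ i j, χ (gen G i j) = P i j := by
  let F : FreeStarAlgebra (V × V) →ₐ[ℂ] B := FreeStarAlgebra.lift fun x => P x.1 x.2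
  have hF : ∀ i j, F (varMatrix V i j) = P i j := fun i j => FreeStarAlgebra.lift_var _ _
  have hrel : ∀ ⦃a b⦄, Rel G a b → F a = F b := by
    intro a b h
    induction h with
    | star_eq i j =>
      rw [FreeStarAlgebra.lift_star, hF, hP.star_eq]
    | mul_self i j => rw [map_mul, hF, hP.mul_self]
    | row_sum i => simp only [map_sum, hF, map_one, hP.row_sum]
    | col_sum j => simp only [map_sum, hF, map_one, hP.col_sum]
    | row_orthogonal i j k h => rw [map_mul, hF, hF, map_zero, hP.row_orthogonal _ _ _ h]
    | col_orthogonal i k j h => rw [map_mul, hF, hF, map_zero, hP.col_orthogonal _ _ _ h]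
    | adj_comm i j =>
      have h := congrFun (congrFun hG i) j
      rw [SimpleGraph.adjMatrix_mul_apply, SimpleGraph.mul_adjMatrix_apply] at h ⊢
      simp only [map_sum, hF, h]
    | adjoint a b _ ih => rw [FreeStarAlgebra.lift_star, FreeStarAlgebra.lift_star, ih]
  refine ⟨RingQuot.liftAlgHom ℂ ⟨F, hrel⟩, fun i j => ?_⟩
  exact (RingQuot.liftAlgHom_mkAlgHom_apply ℂ F hrel _).trans (hF i j)

end QuantumAut

/-! ### Magic unitaries and quantum isomorphisms -/

theorem IsMagicUnitary.isQuantumIso {V W A : Type*} [Fintype V] [Fintype W] [Ring A] [StarRing A]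
    {P : Matrix W V A} (hP : IsMagicUnitary P) {G : SimpleGraph V} {H : SimpleGraph W}
    (hGH : P * G.adjMatrix A = H.adjMatrix A * P) : IsQuantumIso G.Adj H.Adj 1 P where
  mul_self := hP.mul_self
  row_sum := hP.row_sum
  col_sum := hP.col_sum
  row_orth := hP.row_orthogonal
  col_orth := hP.col_orthogonal
  zero_comm i j k l h := by
    have := congrArg star h
    rwa [star_mul, hP.star_eq, hP.star_eq, star_zero] at this
  color_eq i j k l hne := by
    have h : ∑ u with G.Adj u l, P i u = ∑ u with H.Adj i u, P u l := by
      have h := congrFun (congrFun hGH i) l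
      simpa [Matrix.mul_apply, SimpleGraph.adjMatrix_apply, Finset.sum_filter] using h
    have h1 : P i j * (∑ u with G.Adj u l, P i u) = if G.Adj j l then P i j else 0 := by
      rw [Finset.mul_sum]
      split_ifs with hjl
      · rw [Finset.sum_eq_single_of_mem j (by simpa using hjl), hP.mul_self]
        exact fun u _ hu => hP.row_orthogonal _ _ _ hu.symm
      · refine Finset.sum_eq_zero fun u hu => hP.row_orthogonal _ _ _ ?_
        rintro rfl
        exact hjl (Finset.mem_filter.1 hu).2
    have h2 : (∑ u with H.Adj i u, P u l) * P k l = if H.Adj i k then P k l else 0 := by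
      rw [Finset.sum_mul]
      split_ifs with hik
      · rw [Finset.sum_eq_single_of_mem k (by simpa using hik), hP.mul_self]
        exact fun u _ hu => hP.col_orthogonal _ _ _ hu
      · refine Finset.sum_eq_zero fun u hu => hP.col_orthogonal _ _ _ ?_
        rintro rfl
        exact hik (Finset.mem_filter.1 hu).2
    rw [h] at h1
    have h3 := mul_assoc (P i j) (∑ u with H.Adj i u, P u l) (P k l)
    rw [h1, h2, ite_mul, mul_ite, zero_mul, mul_zero] at h3
    by_cases hjl : G.Adj j l <;> by_cases hik : H.Adj i k <;> simp_all

theorem isAddTorsionFree_of_complex (A : Type*) [Ring A] [Algebra ℂ A] : IsAddTorsionFree A :=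
  .of_isTorsionFree ℂ A

theorem ite_mul_ite_eq_zero {B : Type*} [MulZeroClass B] {p q : Prop} {x y : B}
    (h : p → q → x * y = 0) : (if p then x else 0) * (if q then y else 0) = 0 := by
  split_ifs with hp hq
  · exact h hp hq
  all_goals simp

/-- The magic unitary that mixes the identity and the permutation `h` by means of projections that
are constant along `h`. -/
noncomputable def mixMatrix {V B : Type*} [Ring B] (h : Equiv.Perm V) (c : V → B) : Matrix V V B :=
  Matrix.of fun i j => (if i = h j then c j else 0) + if i = j then 1 - c j else 0

theorem isMagicUnitary_mixMatrix {V B : Type*} [Fintype V] [Ring B] [StarRing B]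
    {h : Equiv.Perm V} {c : V → B} (hstar : ∀ j, star (c j) = c j) (hc : ∀ j, c j * c j = c j)
    (hh : ∀ j, c (h j) = c j) : IsMagicUnitary (mixMatrix h c) where
  star_eq i j := by
    simp only [mixMatrix, Matrix.of_apply, star_add, apply_ite star, star_sub, star_one, hstar,
      star_zero]
  mul_self i j := by
    simp only [mixMatrix, Matrix.of_apply]
    split_ifs <;> simp [mul_sub, sub_mul, hc]
  row_sum i := by
    have hi : ∀ j, i = h j ↔ j = h.symm i := fun j => by
      rw [Equiv.eq_symm_apply]
      exact eq_comm
    have hci := hh (h.symm i)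
    rw [h.apply_symm_apply] at hci
    simp [mixMatrix, Finset.sum_add_distrib, hi, ← hci]
  col_sum j := by
    simp [mixMatrix, Finset.sum_add_distrib]
  row_orthogonal i j k hjk := by
    simp only [mixMatrix, Matrix.of_apply, add_mul, mul_add]
    rw [ite_mul_ite_eq_zero fun e e' => absurd (h.injective (e.symm.trans e')) hjk,
      ite_mul_ite_eq_zero fun e e' => ?_, ite_mul_ite_eq_zero fun e e' => ?_,
      ite_mul_ite_eq_zero fun e e' => absurd (e.symm.trans e') hjk]
    · simp
    · rw [show c k = c j by rw [← e', e, hh], mul_sub, hc, mul_one, sub_self]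
    · rw [show c j = c k by rw [← e, e', hh], sub_mul, hc, one_mul, sub_self]
  col_orthogonal i k j hik := by
    simp only [mixMatrix, Matrix.of_apply, add_mul, mul_add]
    rw [ite_mul_ite_eq_zero fun e e' => absurd (e.trans e'.symm) hik,
      ite_mul_ite_eq_zero fun e e' => by rw [sub_mul, hc, one_mul, sub_self],
      ite_mul_ite_eq_zero fun e e' => by rw [mul_sub, hc, mul_one, sub_self],
      ite_mul_ite_eq_zero fun e e' => absurd (e.trans e'.symm) hik]
    simp

/-- The magic unitary of an isomorphism. -/
noncomputable def isoMatrix {V W : Type*} (B : Type*) [Ring B] (f : V ≃ W) : Matrix W V B :=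
  Matrix.of fun i j => if i = f j then 1 else 0

theorem isMagicUnitary_isoMatrix {V W : Type*} [Fintype V] [Fintype W] (B : Type*) [Ring B]
    [StarRing B] (f : V ≃ W) : IsMagicUnitary (isoMatrix B f) where
  star_eq i j := by simp [isoMatrix, apply_ite star]
  mul_self i j := by
    simp only [isoMatrix, Matrix.of_apply]
    split_ifs <;> simp
  row_sum i := by simp [isoMatrix, ← Equiv.symm_apply_eq]
  col_sum j := by simp [isoMatrix]
  row_orthogonal i j k hjk := by
    simp only [isoMatrix, Matrix.of_apply]
    exact ite_mul_ite_eq_zero fun e e' => absurd (f.injective (e.symm.trans e')) hjk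
  col_orthogonal i k j hik := by
    simp only [isoMatrix, Matrix.of_apply]
    exact ite_mul_ite_eq_zero fun e e' => absurd (e.trans e'.symm) hik

theorem isoMatrix_mul_adjMatrix {V W : Type*} [Fintype V] [Fintype W] (B : Type*) [Ring B]
    {G : SimpleGraph V} {H : SimpleGraph W} (f : G ≃g H) :
    isoMatrix B f.toEquiv * G.adjMatrix B = H.adjMatrix B * isoMatrix B f.toEquiv := by
  ext i j
  obtain ⟨x, rfl⟩ := f.surjective i
  simp only [isoMatrix, Matrix.mul_apply, SimpleGraph.adjMatrix_apply, Matrix.of_apply]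
  rw [Finset.sum_eq_single x (fun y _ hy => by simp [hy.symm]) (by simp),
    Finset.sum_eq_single (f j) (fun y _ hy => by simp [hy]) (by simp)]
  simp [f.map_adj_iff]

theorem mixMatrix_const {V B : Type*} [Ring B] (f : Equiv.Perm V) (b : B) :
    mixMatrix f (fun _ => b) = b • isoMatrix B f + (1 - b) • (1 : Matrix V V B) := by
  ext i j
  simp [mixMatrix, isoMatrix, Matrix.one_apply]

theorem adjMatrix_mul_smul {V B : Type*} [Fintype V] [Ring B] (G : SimpleGraph V) (b : B)
    (M : Matrix V V B) : G.adjMatrix B * (b • M) = b • (G.adjMatrix B * M) := by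
  ext i j
  simp [SimpleGraph.adjMatrix_mul_apply, Finset.mul_sum]

theorem mixMatrix_mul_adjMatrix {V B : Type*} [Fintype V] [Ring B] {G : SimpleGraph V}
    (f : G ≃g G) (b : B) :
    mixMatrix f.toEquiv (fun _ => b) * G.adjMatrix B =
      G.adjMatrix B * mixMatrix f.toEquiv (fun _ => b) := by
  rw [mixMatrix_const, add_mul, mul_add, Matrix.smul_mul, Matrix.smul_mul, adjMatrix_mul_smul,
    adjMatrix_mul_smul, isoMatrix_mul_adjMatrix, Matrix.one_mul, Matrix.mul_one]

theorem mul_mixMatrix_apply {V B : Type*} [Fintype V] [Ring B] (M : Matrix V V B)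
    (h : Equiv.Perm V) (c : V → B) (i j : V) :
    (M * mixMatrix h c) i j = M i (h j) * c j + M i j * (1 - c j) := by
  simp only [Matrix.mul_apply, mixMatrix, Matrix.of_apply, mul_add, mul_ite, mul_zero,
    Finset.sum_add_distrib, Finset.sum_ite_eq', Finset.mem_univ, if_true]

theorem exists_noncommuting_projections : ∃ a b : Matrix (Fin 2) (Fin 2) ℂ,
    star a = a ∧ star b = b ∧ a * a = a ∧ b * b = b ∧ a * b ≠ b * a := by
  refine ⟨!![1, 0; 0, 0], !![1 / 2, 1 / 2; 1 / 2, 1 / 2], ?_, ?_, ?_, ?_, fun h => ?_⟩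
  · ext i j
    fin_cases i <;> fin_cases j <;> simp [Matrix.star_apply]
  · ext i j
    fin_cases i <;> fin_cases j <;> simp [Matrix.star_apply]
  · rw [Matrix.mul_fin_two]
    norm_num
  · rw [Matrix.mul_fin_two]
    norm_num
  · have := congrFun (congrFun h 0) 1
    simp at this

end

namespace SimpleGraph

open Classical

variable {V : Type u} {G : SimpleGraph V}

theorem isColorIso_toEquiv {W : Type*} {H : SimpleGraph W} (f : G ≃g H) :
    IsColorIso G.Adj H.Adj f.toEquiv := fun _ _ => propext f.map_adj_iff

/-- The graph isomorphism given by a colour isomorphism of the adjacency relations. -/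
def isoOfColorIso {W : Type*} {H : SimpleGraph W} {f : V ≃ W} (hf : IsColorIso G.Adj H.Adj f) :
    G ≃g H :=
  ⟨f, fun {x y} => Iff.of_eq (hf x y)⟩

theorem isColorAsymmetric_adj_iff : IsColorAsymmetric G.Adj ↔ G.IsAsymmetric := by
  constructor
  · intro h f
    exact RelIso.ext fun x => congrArg (fun p : Equiv.Perm V => p x) (h _ (isColorIso_toEquiv f))
  · intro h f hf
    exact Equiv.ext fun x => congrArg (fun p : G ≃g G => p x) (h (isoOfColorIso hf))

theorem hasDisjointAutomorphisms_adj_iff :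
    HasDisjointAutomorphisms G.Adj ↔ G.SatisfiesSchmidtCriterion := by
  constructor
  · rintro ⟨f, g, hf, hg, hf1, hg1, hd⟩
    refine ⟨isoOfColorIso hf, isoOfColorIso hg, fun h => hf1 ?_, fun h => hg1 ?_, ?_⟩
    · exact Equiv.ext fun x => congrArg (fun p : G ≃g G => p x) h
    · exact Equiv.ext fun x => congrArg (fun p : G ≃g G => p x) h
    · exact Set.disjoint_left.2 fun x hx hx' => (hd x).elim hx hx'
  · rintro ⟨f, g, hf1, hg1, hd⟩
    refine ⟨_, _, isColorIso_toEquiv f, isColorIso_toEquiv g, fun h => hf1 ?_, fun h => hg1 ?_,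
      fun x => ?_⟩
    · exact RelIso.ext fun x => congrArg (fun p : Equiv.Perm V => p x) h
    · exact RelIso.ext fun x => congrArg (fun p : Equiv.Perm V => p x) h
    · by_contra! hcon
      exact Set.disjoint_left.1 hd (show f x ≠ x from hcon.1) hcon.2

variable [Fintype V]

theorem isQuantumIso_gen (G : SimpleGraph V) : IsQuantumIso G.Adj G.Adj 1 (QuantumAut.gen G) :=
  QuantumAut.isMagicUnitary_gen.isQuantumIso QuantumAut.gen_mul_adjMatrix

theorem exists_character (f : G ≃g G) :
    ∃ χ : QuantumAut G →ₐ[ℂ] ℂ, ∀ i j, χ (QuantumAut.gen G i j) = if i = f j then 1 else 0 :=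
  QuantumAut.exists_lift (isMagicUnitary_isoMatrix ℂ f.toEquiv) (isoMatrix_mul_adjMatrix ℂ f)

theorem IsQuantumAsymmetric.isAsymmetric (h : G.IsQuantumAsymmetric) : G.IsAsymmetric := by
  obtain ⟨φ⟩ := h
  intro f
  obtain ⟨χ, hχ⟩ := exists_character f
  obtain ⟨ε, hε⟩ := exists_character (RelIso.refl G.Adj : G ≃g G)
  have key : ∀ (ψ : QuantumAut G →ₐ[ℂ] ℂ) (a : QuantumAut G), ψ a = φ a := by
    intro ψ a
    have ha : a = algebraMap ℂ (QuantumAut G) (φ a) := by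
      apply EquivLike.injective φ
      rw [Algebra.algebraMap_eq_smul_one, map_smul, map_one, smul_eq_mul, mul_one]
    conv_lhs => rw [ha, AlgHom.commutes]
    rfl
  refine RelIso.ext fun x => ?_
  have h1 := (key χ (QuantumAut.gen G (f x) x)).trans (key ε _).symm
  rw [hχ, hε, if_pos rfl] at h1
  by_contra hne
  rw [if_neg hne] at h1
  exact one_ne_zero h1

theorem isQuantumAsymmetric_of_gen (h : ∀ i j, i ≠ j → QuantumAut.gen G i j = 0) :
    G.IsQuantumAsymmetric := by
  obtain ⟨ε, -⟩ := exists_character (RelIso.refl G.Adj : G ≃g G)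
  have hsurj : Function.Surjective (algebraMap ℂ (QuantumAut G)) := by
    intro a
    induction a using QuantumAut.induction with
    | algebraMap c => exact ⟨c, rfl⟩
    | gen i j =>
      by_cases hij : i = j
      · subst hij
        refine ⟨1, ?_⟩
        rw [map_one, ← (isQuantumIso_gen G).row_sum i, Finset.sum_eq_single i
          (fun j _ hj => h i j hj.symm) (by simp)]
      · exact ⟨0, by rw [map_zero, h i j hij]⟩
    | mul a b ha hb =>
      obtain ⟨x, rfl⟩ := ha
      obtain ⟨y, rfl⟩ := hb
      exact ⟨x * y, map_mul _ _ _⟩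
    | add a b ha hb =>
      obtain ⟨x, rfl⟩ := ha
      obtain ⟨y, rfl⟩ := hb
      exact ⟨x + y, map_add _ _ _⟩
  have hinj : Function.Injective (algebraMap ℂ (QuantumAut G)) := fun x y hxy => by
    simpa using congrArg ε hxy
  exact ⟨(StarAlgEquiv.ofAlgEquiv (AlgEquiv.ofBijective (Algebra.ofId ℂ (QuantumAut G))
    ⟨hinj, hsurj⟩) fun c => algebraMap_star_comm c).symm⟩

theorem commutative_of_gen
    (h : ∀ i j k l, Commute (QuantumAut.gen G i j) (QuantumAut.gen G k l))
    (a b : QuantumAut G) : Commute a b := by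
  induction a using QuantumAut.induction with
  | algebraMap c => exact Algebra.commutes c b
  | gen i j =>
    induction b using QuantumAut.induction with
    | algebraMap c => exact (Algebra.commutes c _).symm
    | gen k l => exact h i j k l
    | mul a b ha hb => exact ha.mul_right hb
    | add a b ha hb => exact ha.add_right hb
  | mul a b ha hb => exact ha.mul_left hb
  | add a b ha hb => exact ha.add_left hb

theorem SatisfiesSchmidtCriterion.hasQuantumSymmetry (h : G.SatisfiesSchmidtCriterion) :
    G.HasQuantumSymmetry := by
  obtain ⟨f, g, hf1, hg1, hd⟩ := h
  have hfg : ∀ x, f x = x ∨ g x = x := by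
    intro x
    by_contra! hcon
    exact Set.disjoint_left.1 hd (show f x ≠ x from hcon.1) hcon.2
  have hff : ∀ x, f (f x) = f x ↔ f x = x := fun x => f.injective.eq_iff
  have hgg : ∀ x, g (g x) = g x ↔ g x = x := fun x => g.injective.eq_iff
  obtain ⟨a, b, ha, hb, haa, hbb, hab⟩ := exists_noncommuting_projections
  let c : V → Matrix (Fin 2) (Fin 2) ℂ := fun x => if f x ≠ x then a else if g x ≠ x then b else 0
  let h : Equiv.Perm V := g.toEquiv.trans f.toEquiv
  have happly : ∀ x, h x = f (g x) := fun _ => rfl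
  have hf' : ∀ x, f x ≠ x → h x = f x := fun x hx => by
    rw [happly, (hfg x).resolve_left hx]
  have hg' : ∀ x, g x ≠ x → h x = g x := fun x hx => by
    rw [happly, (hfg (g x)).resolve_right (by rwa [hgg])]
  have hc : ∀ x, c (h x) = c x := by
    intro x
    by_cases h1 : f x = x
    · by_cases h2 : g x = x
      · rw [happly, h2, h1]
      · have h3 : f (g x) = g x := (hfg (g x)).resolve_right (by rwa [hgg])
        simp [c, hg' x h2, hgg, h1, h2, h3]
    · simp [c, hf' x h1, hff, h1]
  have hmagic : IsMagicUnitary (mixMatrix h c) := by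
    refine isMagicUnitary_mixMatrix (fun x => ?_) (fun x => ?_) hc <;> simp only [c] <;>
      split_ifs <;> simp [ha, hb, haa, hbb]
  have hprod : mixMatrix h c =
      mixMatrix f.toEquiv (fun _ => a) * mixMatrix g.toEquiv (fun _ => b) := by
    ext1 i x
    rw [mul_mixMatrix_apply]
    simp only [mixMatrix, Matrix.of_apply, RelIso.coe_fn_toEquiv]
    by_cases h1 : f x = x
    · by_cases h2 : g x = x
      · simp only [c, happly, h1, h2]
        split_ifs <;> simp [mul_sub]
      · have h3 : f (g x) = g x := (hfg (g x)).resolve_right (by rwa [hgg])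
        simp only [c, h1, happly, h3]
        split_ifs <;> simp [mul_sub] <;> simp_all
    · have h2 := (hfg x).resolve_left h1
      simp only [c, happly, h2]
      split_ifs <;> simp [sub_mul, mul_sub]
  obtain ⟨χ, hχ⟩ := QuantumAut.exists_lift hmagic (by
    rw [hprod, Matrix.mul_assoc, mixMatrix_mul_adjMatrix, ← Matrix.mul_assoc,
      mixMatrix_mul_adjMatrix, Matrix.mul_assoc])
  obtain ⟨x, hx⟩ : ∃ x, f x ≠ x := by
    by_contra! hcon
    exact hf1 (RelIso.ext hcon)
  obtain ⟨y, hy⟩ : ∃ y, g y ≠ y := by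
    by_contra! hcon
    exact hg1 (RelIso.ext hcon)
  intro hcomm
  apply hab
  have e1 : χ (QuantumAut.gen G (f x) x) = a := by
    rw [hχ]
    simp [mixMatrix, hf' x hx, hx, c]
  have e2 : χ (QuantumAut.gen G (g y) y) = b := by
    rw [hχ]
    simp [mixMatrix, hg' y hy, hy, (hfg y).resolve_right hy, c]
  rw [← e1, ← e2, ← map_mul, ← map_mul, hcomm]

end SimpleGraph

theorem mainTheorem10 :
    (∀ (V : Type u) [Fintype V] (G : SimpleGraph V), G.IsTreeCograph →
      (G.IsAsymmetric ↔ G.IsQuantumAsymmetric)) ∧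
    (∀ (V W : Type u) [Fintype V] [Fintype W] (G : SimpleGraph V) (H : SimpleGraph W),
      G.IsTreeCograph → H.IsTreeCograph →
      (SimpleGraph.IsQuantumIsomorphic.{u, w} G H ↔ Nonempty (G ≃g H))) ∧
    (∀ (V : Type u) [Fintype V] (G : SimpleGraph V), G.IsTreeCograph →
      (G.HasQuantumSymmetry ↔ G.SatisfiesSchmidtCriterion)) := by
  refine ⟨fun V _ G hG => ⟨fun h => ?_, fun h => h.isAsymmetric⟩,
    fun V W _ _ G H hG hH => ⟨?_, fun ⟨f⟩ => ?_⟩,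
    fun V _ G hG => ⟨fun h => ?_, fun h => h.hasQuantumSymmetry⟩⟩
  · have := isAddTorsionFree_of_complex (QuantumAut G)
    exact SimpleGraph.isQuantumAsymmetric_of_gen ((hG.isTractable (QuantumAut G)).asymm
      (SimpleGraph.isColorAsymmetric_adj_iff.2 h) 1 _ (SimpleGraph.isQuantumIso_gen G))
  · rintro ⟨X, _, _, P, hP, hGH⟩
    have := isAddTorsionFree_of_complex X
    obtain ⟨f, hf⟩ := (hG.isTractable X).rigid W H.Adj 1 P one_ne_zero (hP.isQuantumIso hGH)
    exact ⟨SimpleGraph.isoOfColorIso hf⟩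
  · exact ⟨PUnit.{w + 1} → ℂ, inferInstance, inferInstance, isoMatrix _ f.toEquiv,
      isMagicUnitary_isoMatrix _ _, isoMatrix_mul_adjMatrix _ f⟩
  · by_contra hS
    have := isAddTorsionFree_of_complex (QuantumAut G)
    exact h (SimpleGraph.commutative_of_gen ((hG.isTractable (QuantumAut G)).comm
      (fun hd => hS (SimpleGraph.hasDisjointAutomorphisms_adj_iff.1 hd)) 1 _
      (SimpleGraph.isQuantumIso_gen G)))
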